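/- Let $n\ge 1$ and let $\sigma=\sigma_1\cdots\sigma_n$ be a permutation of $\{1,\dots,n\}$. An interval of $\sigma$ is a set of consecutive values $\{j,j+1,\dots,j+h\}$ of the form $\{\sigma_i,\sigma_{i+1},\dots,\sigma_{i+h}\}$ for some $i$. The interval poset $\tilde P(\sigma)$ is the set of non-empty intervals of $\sigma$ ordered by inclusion, together with the left-to-right order $\{\sigma_1\},\{\sigma_2\},\dots,\{\sigma_n\}$ of its minimal elements; the original interval poset $P(\sigma)$ is the same poset with its minimal elements ordered $\{1\},\{2\},\dots,\{n\}$. Two such plane posets are regarded as equal if there is an order isomorphism between them sending, for every $i$, the $i$-th minimal element of the first to the $i$-th minimal element of the second. A tree interval poset is an interval poset whose Hasse diagram is a tree. For every $n\ge 1$, let $t_n$ be the number of distinct tree interval posets with $n$ minimal elements, that is, of distinct plane posets $\tilde P(\sigma)$ that are trees, where $\sigma$ ranges over the permutations of $\{1,\dots,n\}$. Then $$t_n=\begin{cases}1 & \text{if } n=1,\\[4pt] \displaystyle\frac1n\left[\sum_{i=1}^{n-3}\ \sum_{k=1}^{\min\{i,\frac{n-i-1}{2}\}}\binom{n+i-1}{i}\binom{i}{k}\binom{n-i-k-2}{k-1}+\binom{2n-2}{n-1}\right]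 & \text{if } n>1,\end{cases}$$ where $k$ runs over the integers in the indicated range and empty sums are $0$. The same formula counts the distinct tree interval posets with $n$ minimal elements when the original interval posets $P(\sigma)$ are used instead of $\tilde P(\sigma)$. -/

import Mathlib

namespace IntervalPosets

/-- A set `I` of values is an interval of the permutation `σ` of `{0, …, n-1}` when it is a set of
consecutive values which is the image under `σ` of a set of consecutive positions. -/
def IsInterval {n : ℕ} (σ : Equiv.Perm (Fin n)) (I : Finset (Fin n)) : Prop :=
  (∃ a b : Fin n, I = Finset.Icc a b) ∧
    ∃ c d : Fin n, I = (Finset.Icc c d).map σ.toEmbedding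

/-- The non-empty intervals of `σ`, ordered by inclusion. -/
abbrev NonemptyInterval {n : ℕ} (σ : Equiv.Perm (Fin n)) : Type :=
  {I : Finset (Fin n) // I.Nonempty ∧ IsInterval σ I}

/-- The trivial interval `{j}` of `σ`. -/
def singletonInterval {n : ℕ} (σ : Equiv.Perm (Fin n)) (j : Fin n) : NonemptyInterval σ :=
  ⟨{j}, Finset.singleton_nonempty j, ⟨j, j, by simp⟩, ⟨σ.symm j, σ.symm j, by simp⟩⟩

theorem singletonInterval_injective {n : ℕ} (σ : Equiv.Perm (Fin n)) :
    Function.Injective (singletonInterval σ) := by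
  intro i j h
  exact Finset.singleton_injective (congrArg Subtype.val h)

theorem isMin_iff {n : ℕ} (σ : Equiv.Perm (Fin n)) (I : NonemptyInterval σ) :
    IsMin I ↔ ∃ j, singletonInterval σ j = I := by
  constructor
  · intro h
    obtain ⟨j, hj⟩ := I.2.1
    have hle : singletonInterval σ j ≤ I := Finset.singleton_subset_iff.2 hj
    exact ⟨j, le_antisymm hle (h hle)⟩
  · rintro ⟨j, rfl⟩ J hJ
    have hJ' : J.1 ⊆ {j} := hJ
    have h2 : J.1 = {j} := (Finset.subset_singleton_iff.1 hJ').resolve_left J.2.1.ne_empty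
    exact (show ({j} : Finset (Fin n)) ⊆ J.1 from h2.ge)

/-- A poset with exactly `n` minimal elements, together with the order in which these minimal
elements appear from left to right: `leaf i` is the `i`-th one. -/
structure PlanePoset (n : ℕ) : Type 1 where
  carrier : Type
  order : PartialOrder carrier
  leaf : Fin n → carrier
  leaf_injective : Function.Injective leaf
  isMin_iff_leaf : ∀ x : carrier, IsMin x ↔ ∃ i, leaf i = x

instance {n : ℕ} (P : PlanePoset n) : PartialOrder P.carrier := P.order

/-- Two plane posets are the same when there is an isomorphism of posets between them which
respects the left-to-right order of the minimal elements. -/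
def PlanePoset.Same {n : ℕ} (P Q : PlanePoset n) : Prop :=
  ∃ e : P.carrier ≃o Q.carrier, ∀ i, e (P.leaf i) = Q.leaf i

instance PlanePoset.setoid (n : ℕ) : Setoid (PlanePoset n) where
  r := PlanePoset.Same
  iseqv :=
    { refl := fun P => ⟨OrderIso.refl P.carrier, fun _ => rfl⟩
      symm := fun {P Q} h => by
        obtain ⟨e, he⟩ := h
        exact ⟨e.symm, fun i => by rw [← he i, OrderIso.symm_apply_apply]⟩
      trans := fun {P Q R} h₁ h₂ => by
        obtain ⟨e, he⟩ := h₁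
        obtain ⟨f, hf⟩ := h₂
        exact ⟨e.trans f, fun i => by rw [OrderIso.trans_apply, he i, hf i]⟩ }

/-- A plane poset is a tree when its Hasse diagram is a tree. -/
def PlanePoset.IsTree {n : ℕ} (P : PlanePoset n) : Prop :=
  (SimpleGraph.hasse P.carrier).IsTree

/-- The original interval poset `P(σ)`: the non-empty intervals of `σ` under inclusion, with the
minimal elements in the left-to-right order of their values. -/
def originalIntervalPoset {n : ℕ} (σ : Equiv.Perm (Fin n)) : PlanePoset n where
  carrier := NonemptyInterval σ
  order := inferInstance
  leaf := fun j => singletonInterval σ j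
  leaf_injective := singletonInterval_injective σ
  isMin_iff_leaf := isMin_iff σ

/-- The modified interval poset `P̃(σ)`: the non-empty intervals of `σ` under inclusion, with the
minimal elements `{σ 0}, {σ 1}, …` in this order from left to right. -/
def modifiedIntervalPoset {n : ℕ} (σ : Equiv.Perm (Fin n)) : PlanePoset n where
  carrier := NonemptyInterval σ
  order := inferInstance
  leaf := fun i => singletonInterval σ (σ i)
  leaf_injective := (singletonInterval_injective σ).comp σ.injective
  isMin_iff_leaf := fun I => (isMin_iff σ I).trans
    (σ.surjective.exists (p := fun j => singletonInterval σ j = I))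

/-- The tree interval posets with `n` minimal elements, as plane posets up to isomorphism, for the
original embedding of interval posets. -/
def originalTreeIntervalPosets (n : ℕ) : Set (Quotient (PlanePoset.setoid n)) :=
  {c | ∃ σ : Equiv.Perm (Fin n),
    (originalIntervalPoset σ).IsTree ∧ c = ⟦originalIntervalPoset σ⟧}

/-- The tree interval posets with `n` minimal elements, as plane posets up to isomorphism, for the
modified embedding of interval posets. -/
def treeIntervalPosets (n : ℕ) : Set (Quotient (PlanePoset.setoid n)) :=
  {c | ∃ σ : Equiv.Perm (Fin n),
    (modifiedIntervalPoset σ).IsTree ∧ c = ⟦modifiedIntervalPoset σ⟧}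

/-- The closed formula. In its range `1 ≤ i ≤ n - 3`, `1 ≤ k ≤ min i ((n - i - 1) / 2)` no
subtraction truncates, and rounding `(n - i - 1) / 2` down does not change the range of `k`. -/
def treeFormula (n : ℕ) : ℚ :=
  if n = 1 then 1
  else (1 / (n : ℚ)) *
    ((∑ i ∈ Finset.Icc 1 (n - 3), ∑ k ∈ Finset.Icc 1 (min i ((n - i - 1) / 2)),
        ((n + i - 1).choose i : ℚ) * (i.choose k : ℚ) * ((n - i - k - 2).choose (k - 1) : ℚ)) +
      ((2 * n - 2).choose (n - 1) : ℚ))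

end IntervalPosets

/-!
A permutation has a tree interval poset exactly when its intervals, as blocks of consecutive
positions, are pairwise disjoint or nested, and the modified interval poset determines and is
determined by this laminar family of blocks. Hence `t_n` is the number of laminar families which
are the set of intervals of some permutation.

Such a family is the set of blocks of a plane tree with `n` leaves. No node has exactly three
children: if `I`, `J`, `K` are consecutive blocks and all of `I`, `J`, `K`, `I ∪ J ∪ K` are
intervals, then so is `I ∪ J` or `J ∪ K` (there is no simple permutation of length `3`).
Conversely, every tree without ternary nodes occurs: a node with `a ≥ 4` children is realized by
inflating a simple permutation of length `a`, a binary node by placing the values of its right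
subtree above those of its left subtree. Reversing the order of values inside the subtrees where
necessary prevents the extra intervals that would otherwise straddle the boundary.

Plane forests with prescribed arities satisfy a linear recursion, whose solution is given by the
coefficients of the powers of `(1 - S)⁻¹` with `S = ∑ X ^ (a - 1)` over the allowed arities `a` (the
Lagrange inversion formula); for all arities except `3` they are expanded by the binomial theorem.
Finally, `P(σ)` and `P̃(σ⁻¹)` are the same plane poset, so both embeddings give the same count.
-/

namespace IntervalPosets

/-! ### Plane forests -/

/-- Ordered forests with `m` trees and `n` leaves in which the number of children of every inner
node is at least `2` and belongs to `A`. They are built in postorder: `leaf` adds a new tree on the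
right, `node` joins the `e + 2` rightmost trees below a new root. -/
inductive PlaneForest (A : Set ℕ) : ℕ → ℕ → Type
  | nil : PlaneForest A 0 0
  | leaf {m n : ℕ} (f : PlaneForest A m n) : PlaneForest A (m + 1) (n + 1)
  | node {m n : ℕ} (e : ℕ) (he : e + 2 ∈ A) (f : PlaneForest A (m + e + 2) n) :
      PlaneForest A (m + 1) n

/-- The set `G` of blocks `[c, d)` is laminar: two of its members are disjoint or nested. -/
def IsLaminar (G : Finset (ℕ × ℕ)) : Prop :=
  ∀ ⦃c d c' d' : ℕ⦄, (c, d) ∈ G → (c', d') ∈ G → c < c' → c' < d → d' ≤ d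

namespace PlaneForest

variable {A : Set ℕ} {m n : ℕ}

/-- The boundaries between consecutive trees: if `i < m`, then the leaves of the `i`-th tree are
those with a number in `[cut f i, cut f (i + 1))`. For `i > m` the value is `n`. -/
def cut : {m n : ℕ} → PlaneForest A m n → ℕ → ℕ
  | _, _, nil, _ => 0
  | m + 1, n + 1, leaf f, i => if i ≤ m then f.cut i else n + 1
  | m + 1, n, node _ _ f, i => if i ≤ m then f.cut i else n

/-- The intervals `[c, d)` of leaves which lie below the nodes of a forest. -/
def blocks : {m n : ℕ} → PlaneForest A m n → Finset (ℕ × ℕ)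
  | _, _, nil => ∅
  | _, n + 1, leaf f => insert (n, n + 1) f.blocks
  | m + 1, n, node _ _ f => insert (f.cut m, n) f.blocks

theorem cut_zero (f : PlaneForest A m n) : f.cut 0 = 0 := by
  induction f with
  | nil => rfl
  | leaf f ih => simp [cut, ih]
  | node e he f ih => simp [cut, ih]

theorem cut_self (f : PlaneForest A m n) : f.cut m = n := by
  cases f <;> simp [cut]

theorem cut_leaf_of_le (f : PlaneForest A m n) {i : ℕ} (hi : i ≤ m) : f.leaf.cut i = f.cut i :=
  if_pos hi

theorem cut_node_of_le {e : ℕ} (he : e + 2 ∈ A) (f : PlaneForest A (m + e + 2) n) {i : ℕ}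
    (hi : i ≤ m) : (f.node e he).cut i = f.cut i :=
  if_pos hi

theorem cut_lt_cut_succ (f : PlaneForest A m n) {i : ℕ} (hi : i < m) :
    f.cut i < f.cut (i + 1) := by
  induction f generalizing i with
  | nil => omega
  | @leaf m n f ih =>
    rcases Nat.lt_succ_iff_lt_or_eq.1 hi with hi | rfl
    · rw [cut_leaf_of_le f hi.le, cut_leaf_of_le f hi]
      exact ih hi
    · rw [cut_leaf_of_le f le_rfl, cut_self, cut_self]
      exact n.lt_succ_self
  | @node m n e he f ih =>
    rcases Nat.lt_succ_iff_lt_or_eq.1 hi with hi | rfl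
    · rw [cut_node_of_le he f hi.le, cut_node_of_le he f hi]
      exact ih (by omega)
    · have hmono : StrictMonoOn f.cut (Set.Iic (i + e + 2)) :=
        strictMonoOn_Iic_of_lt_succ fun j hj => ih hj
      have hlt : i < i + e + 2 := by omega
      rw [cut_node_of_le he f le_rfl, cut_self]
      exact (hmono hlt.le Set.self_mem_Iic hlt).trans_eq f.cut_self

theorem strictMonoOn_cut (f : PlaneForest A m n) : StrictMonoOn f.cut (Set.Iic m) :=
  strictMonoOn_Iic_of_lt_succ fun _ hi => f.cut_lt_cut_succ hi

theorem cut_le_cut (f : PlaneForest A m n) {i j : ℕ} (hij : i ≤ j) (hj : j ≤ m) :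
    f.cut i ≤ f.cut j :=
  f.strictMonoOn_cut.monotoneOn (hij.trans hj) hj hij

theorem cut_lt (f : PlaneForest A m n) {i : ℕ} (hi : i < m) : f.cut i < n := by
  simpa only [cut_self] using f.strictMonoOn_cut hi.le Set.self_mem_Iic hi

theorem lt_and_le_of_mem_blocks (f : PlaneForest A m n) {c d : ℕ} (h : (c, d) ∈ f.blocks) :
    c < d ∧ d ≤ n := by
  induction f with
  | nil => simp [blocks] at h
  | leaf f ih =>
    simp only [blocks, Finset.mem_insert, Prod.mk.injEq] at h
    rcases h with ⟨rfl, rfl⟩ | h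
    · omega
    · have := ih h
      omega
  | node e he f ih =>
    simp only [blocks, Finset.mem_insert, Prod.mk.injEq] at h
    rcases h with ⟨rfl, rfl⟩ | h
    · exact ⟨f.cut_lt (by omega), le_rfl⟩
    · exact ih h

theorem cut_le_or_le_cut (f : PlaneForest A m n) {c d : ℕ} (h : (c, d) ∈ f.blocks) {i : ℕ}
    (hi : i ≤ m) : f.cut i ≤ c ∨ d ≤ f.cut i := by
  induction f generalizing i with
  | nil => simp [blocks] at h
  | @leaf m n f ih =>
    rcases hi.lt_or_eq with hi | rfl
    · rw [cut_leaf_of_le f (by omega)]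
      simp only [blocks, Finset.mem_insert, Prod.mk.injEq] at h
      rcases h with ⟨rfl, rfl⟩ | h
      · exact Or.inl ((f.cut_le_cut (Nat.lt_succ_iff.1 hi) le_rfl).trans_eq f.cut_self)
      · exact ih h (by omega)
    · rw [cut_self]
      exact Or.inr (f.leaf.lt_and_le_of_mem_blocks h).2
  | @node m n e he f ih =>
    rcases hi.lt_or_eq with hi | rfl
    · rw [cut_node_of_le he f (by omega)]
      simp only [blocks, Finset.mem_insert, Prod.mk.injEq] at h
      rcases h with ⟨rfl, rfl⟩ | h
      · exact Or.inl (f.cut_le_cut (Nat.lt_succ_iff.1 hi) (by omega))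
      · exact ih h (by omega)
    · rw [cut_self]
      exact Or.inr ((f.node e he).lt_and_le_of_mem_blocks h).2

theorem mk_cut_mem_blocks (f : PlaneForest A m n) {i : ℕ} (hi : i < m) :
    (f.cut i, f.cut (i + 1)) ∈ f.blocks := by
  induction f generalizing i with
  | nil => omega
  | @leaf m n f ih =>
    rcases (Nat.lt_succ_iff_lt_or_eq).1 hi with hi | rfl
    · rw [cut_leaf_of_le f hi.le, cut_leaf_of_le f hi]
      exact Finset.mem_insert_of_mem (ih hi)
    · rw [cut_leaf_of_le f le_rfl, cut_self, cut_self]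
      exact Finset.mem_insert_self _ _
  | @node m n e he f ih =>
    rcases (Nat.lt_succ_iff_lt_or_eq).1 hi with hi | rfl
    · rw [cut_node_of_le he f hi.le, cut_node_of_le he f hi]
      exact Finset.mem_insert_of_mem (ih (by omega))
    · rw [cut_node_of_le he f le_rfl, cut_self]
      exact Finset.mem_insert_self _ _

theorem isLaminar_blocks (f : PlaneForest A m n) : IsLaminar f.blocks := by
  induction f with
  | nil => intro c d c' d' h; simp [blocks] at h
  | @leaf m n f ih =>
    intro c d c' d' h h' hc hd
    simp only [blocks, Finset.mem_insert, Prod.mk.injEq] at h h'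
    rcases h' with ⟨rfl, rfl⟩ | h'
    · rcases h with ⟨rfl, rfl⟩ | h
      · exact le_rfl
      · exact absurd (f.lt_and_le_of_mem_blocks h).2 hd.not_ge
    · rcases h with ⟨rfl, rfl⟩ | h
      · have := (f.lt_and_le_of_mem_blocks h').2
        omega
      · exact ih h h' hc hd
  | @node m n e he f ih =>
    intro c d c' d' h h' hc hd
    simp only [blocks, Finset.mem_insert, Prod.mk.injEq] at h h'
    rcases h' with ⟨rfl, rfl⟩ | h'
    · rcases h with ⟨rfl, rfl⟩ | h
      · exact le_rfl
      · exact (((f.cut_le_or_le_cut h (by omega)).resolve_left hc.not_ge).not_gt hd).elim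
    · rcases h with ⟨rfl, rfl⟩ | h
      · exact (f.lt_and_le_of_mem_blocks h').2
      · exact ih h h' hc hd

theorem cut_le_of_mk_mem_blocks (f : PlaneForest A (m + 1) n) {c : ℕ} (h : (c, n) ∈ f.blocks) :
    f.cut m ≤ c :=
  (f.cut_le_or_le_cut h m.le_succ).resolve_right (f.cut_lt m.lt_succ_self).not_ge

theorem cut_last_eq_of_blocks_eq {m' : ℕ} {f : PlaneForest A (m + 1) n}
    {g : PlaneForest A (m' + 1) n} (h : f.blocks = g.blocks) : f.cut m = g.cut m' := by
  have hf := f.mk_cut_mem_blocks m.lt_succ_self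
  have hg := g.mk_cut_mem_blocks m'.lt_succ_self
  rw [cut_self] at hf hg
  exact le_antisymm (f.cut_le_of_mk_mem_blocks (h ▸ hg)) (g.cut_le_of_mk_mem_blocks (h ▸ hf))

theorem mk_notMem_blocks_of_lt (f : PlaneForest A m n) (c : ℕ) {d : ℕ} (h : n < d) :
    (c, d) ∉ f.blocks :=
  fun hc => (f.lt_and_le_of_mem_blocks hc).2.not_gt h

theorem mk_cut_notMem_blocks (f : PlaneForest A m n) {i : ℕ} (hi : i + 1 < m) :
    (f.cut i, n) ∉ f.blocks := by
  intro h
  have := f.cut_lt_cut_succ (i.lt_succ_self.trans hi)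
  have := f.cut_lt hi
  have := f.cut_le_or_le_cut h hi.le
  omega

theorem blocks_leaf_ne_blocks_node {e m' : ℕ} (f : PlaneForest A m n) (he : e + 2 ∈ A)
    (g : PlaneForest A (m' + e + 2) (n + 1)) : f.leaf.blocks ≠ (g.node e he).blocks := by
  intro h
  have hmem : (g.cut m', n + 1) ∈ f.leaf.blocks := h ▸ Finset.mem_insert_self _ _
  rcases Finset.mem_insert.1 hmem with heq | hmem
  · have := g.cut_lt_cut_succ (i := m') (by omega)
    have := g.cut_lt (i := m' + 1) (by omega)
    have := congrArg Prod.fst heq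
    simp only at this
    omega
  · exact f.mk_notMem_blocks_of_lt _ n.lt_succ_self hmem

theorem cut_eq_and_blocks_eq_of_blocks_node_eq {e e' m' : ℕ} {he : e + 2 ∈ A} {he' : e' + 2 ∈ A}
    {f : PlaneForest A (m + e + 2) n} {g : PlaneForest A (m' + e' + 2) n}
    (h : (f.node e he).blocks = (g.node e' he').blocks) :
    f.cut m = g.cut m' ∧ f.blocks = g.blocks := by
  have hcut : f.cut m = g.cut m' := by
    simpa only [cut_node_of_le _ _ le_rfl] using cut_last_eq_of_blocks_eq h
  refine ⟨hcut, ?_⟩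
  have herase := congrArg (Finset.erase · (f.cut m, n)) h
  simp only [blocks] at herase
  rwa [← hcut, Finset.erase_insert (f.mk_cut_notMem_blocks (by omega)),
    Finset.erase_insert (hcut ▸ g.mk_cut_notMem_blocks (by omega))] at herase

theorem sigma_eq_of_blocks_eq {m' : ℕ} {f : PlaneForest A m n} {g : PlaneForest A m' n}
    (h : f.blocks = g.blocks) :
    (⟨m, f⟩ : Σ k, PlaneForest A k n) = ⟨m', g⟩ := by
  induction f generalizing m' with
  | nil =>
    cases g with
    | nil => rfl
    | node e he g => exact absurd h.symm (Finset.insert_ne_empty _ _)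
  | @leaf m n f ih =>
    cases g with
    | leaf g =>
      have hfg : f.blocks = g.blocks := by
        simpa only [blocks, Finset.erase_insert (mk_notMem_blocks_of_lt _ _ n.lt_succ_self)]
          using congrArg (Finset.erase · (n, n + 1)) h
      cases ih hfg
      rfl
    | node e he g => exact absurd h (f.blocks_leaf_ne_blocks_node he g)
  | @node m n e he f ih =>
    cases g with
    | nil => exact absurd h (Finset.insert_ne_empty _ _)
    | leaf g => exact absurd h.symm (g.blocks_leaf_ne_blocks_node he f)
    | @node m' _ e' he' g =>
      obtain ⟨hcut, hfg⟩ := cut_eq_and_blocks_eq_of_blocks_node_eq h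
      have heq := ih hfg
      have hm : m + e + 2 = m' + e' + 2 := congrArg Sigma.fst heq
      have hfcut : f.cut = g.cut := congrArg (fun s => s.2.cut) heq
      obtain rfl : m = m' := f.strictMonoOn_cut.injOn (Set.mem_Iic.2 (by omega))
        (Set.mem_Iic.2 (by omega)) (hcut.trans (congrFun hfcut m').symm)
      obtain rfl : e = e' := by omega
      cases heq
      rfl

theorem blocks_injective : Function.Injective (blocks : PlaneForest A m n → Finset (ℕ × ℕ)) :=
  fun _ _ h => eq_of_heq (Sigma.mk.inj (sigma_eq_of_blocks_eq h)).2

instance : Finite (PlaneForest A m n) :=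
  Finite.of_injective
    (fun f => (⟨f.blocks, Finset.mem_powerset.2 fun b hb => by
      have := f.lt_and_le_of_mem_blocks (c := b.1) (d := b.2) hb
      exact Finset.mem_product.2 ⟨Finset.mem_range.2 (by omega), Finset.mem_range.2 (by omega)⟩⟩ :
      (Finset.range (n + 1) ×ˢ Finset.range (n + 1)).powerset))
    fun _ _ h => blocks_injective (congrArg Subtype.val h)

instance : Unique (PlaneForest A 0 0) where
  default := nil
  uniq f := by cases f; rfl

instance : IsEmpty (PlaneForest A 0 (n + 1)) :=
  ⟨fun f => by cases f⟩

theorem le (f : PlaneForest A m n) : m ≤ n := by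
  induction f with
  | nil => exact le_rfl
  | leaf _ ih => omega
  | node _ _ _ ih => omega

/-- A forest with leaves and trees arises by adding a single leaf on the right or by joining its
rightmost trees. If it has `N` leaves more than trees, then at most `N + 1` trees can be joined. -/
def equivSum {N : ℕ} (h : m + N = n) : PlaneForest A (m + 1) (n + 1) ≃
    PlaneForest A m n ⊕
      Σ e : {e // e ∈ Finset.range N ∧ e + 2 ∈ A}, PlaneForest A (m + e + 2) (n + 1) where
  toFun
    | leaf f => Sum.inl f
    | node e he f => Sum.inr ⟨⟨e, Finset.mem_range.2 (by have := f.le; omega), he⟩, f⟩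
  invFun
    | Sum.inl f => leaf f
    | Sum.inr ⟨e, f⟩ => node e e.2.2 f
  left_inv f := by cases f <;> rfl
  right_inv
    | Sum.inl _ => rfl
    | Sum.inr ⟨_, _⟩ => rfl

open Classical in
theorem card_succ_succ {N : ℕ} (h : m + N = n) :
    Nat.card (PlaneForest A (m + 1) (n + 1)) = Nat.card (PlaneForest A m n) +
      ∑ e ∈ Finset.range N,
        if e + 2 ∈ A then Nat.card (PlaneForest A (m + e + 2) (n + 1)) else 0 := by
  have : Fintype {e // e ∈ Finset.range N ∧ e + 2 ∈ A} :=
    Fintype.subtype {e ∈ Finset.range N | e + 2 ∈ A} fun e => Finset.mem_filter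
  rw [Nat.card_congr (equivSum h), Nat.card_sum, Nat.card_sigma, ← Finset.sum_filter]
  congr 1
  exact (Finset.sum_subtype _ (fun e => Finset.mem_filter) fun e =>
    Nat.card (PlaneForest A (m + e + 2) (n + 1))).symm

end PlaneForest

/-! ### Counting plane forests -/

section Counting

open PowerSeries
open Finset.HasAntidiagonal (antidiagonal mem_antidiagonal)

section LagrangeSeries

variable {R : Type*} [CommRing R] {S L : R⟦X⟧}

theorem mul_pow_succ_of_mul_one_sub_eq_one (hL : L * (1 - S) = 1) (n : ℕ) :
    S * L ^ (n + 1) = L ^ (n + 1) - L ^ n := by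
  linear_combination -L ^ n * hL

theorem derivative_pow_of_mul_one_sub_eq_one (hL : L * (1 - S) = 1) (n : ℕ) :
    d⁄dX R (L ^ n) = n * (L ^ (n + 1) * d⁄dX R S) := by
  have hdL : d⁄dX R L = L ^ 2 * d⁄dX R S := by
    rw [Derivation.leibniz_of_mul_eq_one _ hL, map_sub, derivative_one, zero_sub, smul_neg,
      neg_smul, neg_neg, smul_eq_mul]
  rcases n with _ | n
  · simp
  · rw [derivative_pow, hdL, Nat.add_sub_cancel]
    ring

theorem coeff_X_mul_derivative (f : R⟦X⟧) (i : ℕ) : coeff i (X * d⁄dX R f) = i * coeff i f := by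
  rcases i with _ | i
  · simp
  · rw [coeff_succ_X_mul, coeff_derivative, mul_comm, Nat.cast_succ]

theorem natCast_mul_sum_antidiagonal (hL : L * (1 - S) = 1) (r n N : ℕ) :
    (n : R) * ∑ ij ∈ antidiagonal N,
        coeff ij.1 S * ((r + ij.1 : ℕ) * coeff ij.2 (L ^ (n + 1))) =
      n * r * (coeff N (L ^ (n + 1)) - coeff N (L ^ n)) + N * coeff N (L ^ n) := by
  -- The claim compares the coefficients of `X ^ N` in this identity.
  have hseries : (n : R⟦X⟧) * (((r : R⟦X⟧) * S + X * d⁄dX R S) * L ^ (n + 1)) =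
      (n : R⟦X⟧) * ((r : R⟦X⟧) * (L ^ (n + 1) - L ^ n)) + X * d⁄dX R (L ^ n) := by
    rw [derivative_pow_of_mul_one_sub_eq_one hL, ← mul_pow_succ_of_mul_one_sub_eq_one hL]
    ring
  have hcoeff := congrArg (coeff N) hseries
  simp only [← map_natCast (C (R := R)), map_add, map_sub, coeff_C_mul, coeff_X_mul_derivative,
    coeff_mul N (_ + _)] at hcoeff
  rw [mul_assoc, ← hcoeff]
  congr 1
  refine Finset.sum_congr rfl fun ij _ => ?_
  push_cast
  ring

theorem pow_succ_eq_subst (hL : L * (1 - S) = 1) (hS : constantCoeff S = 0) (d : ℕ) :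
    L ^ (d + 1) = (PowerSeries.mk fun i => ((d + i).choose d : R)).subst S := by
  have hsubst : HasSubst S := HasSubst.of_constantCoeff_zero' hS
  have hinv := congrArg (substAlgHom (R := R) hsubst)
    (mk_add_choose_mul_one_sub_pow_eq_one (S := R) (d := d))
  rw [map_mul, map_pow, map_sub, map_one, substAlgHom_X, coe_substAlgHom] at hinv
  have hinv' : (1 - S) ^ (d + 1) * L ^ (d + 1) = 1 := by
    rw [← mul_pow, mul_comm, hL, one_pow]
  exact (left_inv_eq_right_inv hinv hinv').symm

theorem coeff_pow_succ_of_mul_one_sub_eq_one (hL : L * (1 - S) = 1) (hS : constantCoeff S = 0)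
    (d : ℕ) (j : ℕ) : coeff j (L ^ (d + 1)) =
      ∑ i ∈ Finset.range (j + 1), ((d + i).choose d : R) * coeff j (S ^ i) := by
  rw [pow_succ_eq_subst hL hS, coeff_subst' (HasSubst.of_constantCoeff_zero' hS),
    finsum_eq_sum_of_support_subset (s := Finset.range (j + 1))]
  · simp only [coeff_mk, smul_eq_mul]
  · intro i hi
    by_contra hlt
    rw [Finset.coe_range, Set.mem_Iio, not_lt] at hlt
    refine hi ?_
    obtain ⟨T, rfl⟩ := X_dvd_iff.2 hS
    beta_reduce
    rw [mul_pow, coeff_X_pow_mul', if_neg (by omega), smul_zero]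

end LagrangeSeries

/-- The generating function `∑ X ^ (a - 1)` of the arities `a ≥ 2` in `A`: a node with `a` children
lowers the number of trees by `a - 1`. -/
noncomputable def aritySeries (A : Set ℕ) : ℚ⟦X⟧ :=
  X * PowerSeries.mk ({e | e + 2 ∈ A}.indicator 1)

theorem constantCoeff_aritySeries (A : Set ℕ) : constantCoeff (aritySeries A) = 0 :=
  X_dvd_iff.1 (dvd_mul_right _ _)

theorem inv_one_sub_aritySeries_mul (A : Set ℕ) :
    (1 - aritySeries A)⁻¹ * (1 - aritySeries A) = 1 :=
  PowerSeries.inv_mul_cancel _ (by simp [constantCoeff_aritySeries])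

namespace PlaneForest

variable {A : Set ℕ} {m n : ℕ}

theorem card_succ_succ_eq_sum_antidiagonal {N : ℕ} (h : m + N = n) :
    (Nat.card (PlaneForest A (m + 1) (n + 1)) : ℚ) = Nat.card (PlaneForest A m n) +
      ∑ ij ∈ antidiagonal N,
        coeff ij.1 (aritySeries A) * Nat.card (PlaneForest A (m + 1 + ij.1) (n + 1)) := by
  classical
  rw [card_succ_succ h, Finset.Nat.sum_antidiagonal_eq_sum_range_succ_mk, Finset.sum_range_succ',
    coeff_zero_eq_constantCoeff_apply, constantCoeff_aritySeries, zero_mul, add_zero]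
  push_cast
  congr 1
  refine Finset.sum_congr rfl fun e _ => ?_
  rw [aritySeries, coeff_succ_X_mul, coeff_mk, Set.indicator_apply, ite_mul, zero_mul,
    Pi.one_apply, one_mul, show m + 1 + (e + 1) = m + e + 2 by omega]
  rfl

theorem natCast_mul_card {N : ℕ} (h : m + N = n) : (n : ℚ) * Nat.card (PlaneForest A m n) =
    m * coeff N ((1 - aritySeries A)⁻¹ ^ n) := by
  induction n generalizing m N with
  | zero =>
    obtain ⟨rfl, rfl⟩ : m = 0 ∧ N = 0 := by omega
    simp
  | succ n ih =>
    rcases m with _ | m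
    · simp
    induction N using Nat.strong_induction_on generalizing m with
    | _ N ihN =>
      have hmN : m + N = n := by omega
      have hjoin : ((n + 1 : ℕ) : ℚ) * ∑ ij ∈ antidiagonal N, coeff ij.1 (aritySeries A) *
            Nat.card (PlaneForest A (m + 1 + ij.1) (n + 1)) =
          ∑ ij ∈ antidiagonal N, coeff ij.1 (aritySeries A) *
            ((m + 1 + ij.1 : ℕ) * coeff ij.2 ((1 - aritySeries A)⁻¹ ^ (n + 1))) := by
        rw [Finset.mul_sum]
        refine Finset.sum_congr rfl fun ij hij => ?_
        rw [mem_antidiagonal] at hij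
        rcases Nat.eq_zero_or_pos ij.1 with h0 | hpos
        · rw [h0, coeff_zero_eq_constantCoeff_apply, constantCoeff_aritySeries]
          simp
        · have := ihN ij.2 (by omega) (m + ij.1) (by omega)
          rw [mul_left_comm, add_right_comm m 1, this]
      rw [card_succ_succ_eq_sum_antidiagonal hmN, mul_add, hjoin]
      rcases Nat.eq_zero_or_pos n with rfl | hn
      · obtain ⟨rfl, rfl⟩ : m = 0 ∧ N = 0 := by omega
        simp [constantCoeff_aritySeries]
      · have hprev := ih hmN
        have hsum := natCast_mul_sum_antidiagonal (inv_one_sub_aritySeries_mul A) (m + 1) n N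
        have hn' : (n : ℚ) ≠ 0 := Nat.cast_ne_zero.2 hn.ne'
        have hcast : (n : ℚ) = m + N := by rw [← hmN, Nat.cast_add]
        refine mul_left_cancel₀ hn' ?_
        push_cast at hsum ⊢
        linear_combination ((n : ℚ) + 1) * hprev + hsum -
          coeff N ((1 - aritySeries A)⁻¹ ^ n) * hcast

end PlaneForest

theorem aritySeries_compl_three :
    aritySeries {3}ᶜ = X * (1 + X ^ 2 * PowerSeries.mk 1) := by
  classical
  rw [aritySeries]
  congr 1
  ext e
  rw [coeff_mk, Set.indicator_apply, map_add, coeff_one, coeff_X_pow_mul', coeff_mk]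
  rcases e with _ | _ | e <;> simp

theorem coeff_X_sq_mul_mk_one_pow {R : Type*} [CommRing R] (d : ℕ) {k : ℕ} (hk : 1 ≤ k) :
    coeff d ((X ^ 2 * PowerSeries.mk 1 : R⟦X⟧) ^ k) =
      if 2 * k ≤ d then ((d - k - 1).choose (k - 1) : R) else 0 := by
  obtain ⟨k, rfl⟩ := Nat.exists_eq_add_of_le' hk
  rw [mul_pow, ← pow_mul, coeff_X_pow_mul', mk_one_pow_eq_mk_choose_add, coeff_mk]
  refine if_ctx_congr Iff.rfl (fun h => ?_) fun _ => rfl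
  rw [show k + (d - 2 * (k + 1)) = d - (k + 1) - 1 by omega, Nat.add_sub_cancel]

theorem coeff_aritySeries_compl_three_pow {d i : ℕ} (hi : i ≤ d) :
    coeff d (aritySeries {3}ᶜ ^ i) =
      (if i = d then 1 else 0) + ∑ k ∈ Finset.Icc 1 (min i ((d - i) / 2)),
        (i.choose k : ℚ) * ((d - i - k - 1).choose (k - 1) : ℚ) := by
  rw [aritySeries_compl_three, mul_pow, coeff_X_pow_mul', if_pos hi, add_comm (1 : ℚ⟦X⟧), add_pow,
    map_sum, Finset.range_eq_Ico, Finset.sum_eq_sum_Ico_succ_bot i.succ_pos]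
  congr 1
  · simp only [pow_zero, one_pow, mul_one, Nat.choose_zero_right, Nat.cast_one, coeff_one]
    exact if_congr (by omega) rfl rfl
  · have hterm : ∀ k ∈ Finset.Ico 1 (i + 1), coeff (d - i)
        ((X ^ 2 * PowerSeries.mk 1 : ℚ⟦X⟧) ^ k * 1 ^ (i - k) * (i.choose k : ℚ⟦X⟧)) =
        if 2 * k ≤ d - i then (i.choose k : ℚ) * ((d - i - k - 1).choose (k - 1) : ℚ) else 0 := by
      intro k hk
      rw [one_pow, mul_one, mul_comm, ← map_natCast (C (R := ℚ)), coeff_C_mul,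
        coeff_X_sq_mul_mk_one_pow _ (Finset.mem_Ico.1 hk).1, mul_ite, mul_zero]
    rw [zero_add, Finset.sum_congr rfl hterm, ← Finset.sum_filter]
    refine Finset.sum_congr (Finset.ext fun k => ?_) fun _ _ => rfl
    rw [Finset.mem_filter, Finset.mem_Ico, Finset.mem_Icc]
    omega

theorem coeff_inv_one_sub_aritySeries_compl_three_pow (d : ℕ) :
    coeff d ((1 - aritySeries {3}ᶜ)⁻¹ ^ (d + 1)) =
      (∑ i ∈ Finset.Icc 1 (d - 2), ∑ k ∈ Finset.Icc 1 (min i ((d - i) / 2)),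
        ((d + i).choose i : ℚ) * (i.choose k : ℚ) * ((d - i - k - 1).choose (k - 1) : ℚ)) +
      ((2 * d).choose d : ℚ) := by
  have hterm : ∀ i ∈ Finset.range (d + 1),
      ((d + i).choose d : ℚ) * coeff d (aritySeries {3}ᶜ ^ i) =
        (∑ k ∈ Finset.Icc 1 (min i ((d - i) / 2)),
          ((d + i).choose i : ℚ) * (i.choose k : ℚ) * ((d - i - k - 1).choose (k - 1) : ℚ)) +
        if i = d then ((2 * d).choose d : ℚ) else 0 := by
    intro i hi
    rw [coeff_aritySeries_compl_three_pow (Finset.mem_range_succ_iff.1 hi), mul_add,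
      Finset.mul_sum, mul_ite, mul_one, mul_zero, add_comm, Nat.choose_symm_add]
    simp only [mul_assoc]
    congr 1
    exact if_ctx_congr Iff.rfl (fun h => by rw [h, two_mul]) fun _ => rfl
  rw [coeff_pow_succ_of_mul_one_sub_eq_one (inv_one_sub_aritySeries_mul _)
      (constantCoeff_aritySeries _), Finset.sum_congr rfl hterm, Finset.sum_add_distrib,
    Finset.sum_ite_eq', if_pos (Finset.self_mem_range_succ d)]
  congr 1
  refine (Finset.sum_subset (fun i hi => ?_) fun i hi hi' => ?_).symm
  · rw [Finset.mem_Icc] at hi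
    rw [Finset.mem_range]
    omega
  · rw [Finset.mem_range] at hi
    rw [Finset.mem_Icc] at hi'
    rw [Finset.Icc_eq_empty (by omega), Finset.sum_empty]

theorem card_planeForest_compl_three {n : ℕ} (hn : 1 ≤ n) :
    (Nat.card (PlaneForest {3}ᶜ 1 n) : ℚ) = treeFormula n := by
  obtain ⟨d, rfl⟩ := Nat.exists_eq_add_of_le' hn
  have hcard := PlaneForest.natCast_mul_card (A := {3}ᶜ) (add_comm 1 d)
  have hne : ((d + 1 : ℕ) : ℚ) ≠ 0 := Nat.cast_ne_zero.2 d.succ_ne_zero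
  rw [Nat.cast_one, one_mul] at hcard
  rw [treeFormula]
  split_ifs with h1
  · obtain rfl : d = 0 := by omega
    simpa [constantCoeff_aritySeries] using hcard
  · rw [one_div, eq_inv_mul_iff_mul_eq₀ hne, hcard,
      coeff_inv_one_sub_aritySeries_compl_three_pow]
    congr 1
    refine Finset.sum_congr rfl fun i _ => ?_
    rw [show d + 1 - i - 1 = d - i by omega]
    refine Finset.sum_congr rfl fun k _ => ?_
    rw [show d + 1 + i - 1 = d + i by omega, show d + 1 - i - k - 2 = d - i - k - 1 by omega]

end Counting

/-! ### Realizing plane forests by sequences -/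

/-- The values of `v` at the positions in the block `[c, d)` form a set of consecutive values among
those at the positions in `[p, q)`. -/
def IsConvexBlock {α : Type*} [LE α] (v : ℕ → α) (p q c d : ℕ) : Prop :=
  ∀ ⦃x y z : ℕ⦄, c ≤ x → x < d → c ≤ y → y < d → p ≤ z → z < q → v x ≤ v z → v z ≤ v y →
    c ≤ z ∧ z < d

theorem isConvexBlock_self {α : Type*} [LE α] (v : ℕ → α) (p q : ℕ) : IsConvexBlock v p q p q :=
  fun _ _ _ _ _ _ _ hz hz' _ _ => ⟨hz, hz'⟩

/-- The blocks contained in `[p, q)` that belong to `F` are the intervals of the sequence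
`v p, …, v (q - 1)`, which has distinct entries. -/
structure Realizes (F : Finset (ℕ × ℕ)) (p q : ℕ) (v : ℕ → ℤ) : Prop where
  injOn : Set.InjOn v (Set.Ico p q)
  isConvexBlock_iff : ∀ c d, p ≤ c → c < d → d ≤ q → (IsConvexBlock v p q c d ↔ (c, d) ∈ F)

theorem IsConvexBlock.neg {v : ℕ → ℤ} {p q c d : ℕ} (h : IsConvexBlock v p q c d) :
    IsConvexBlock (-v) p q c d := fun _ _ _ hx hx' hy hy' hz hz' hxz hzy =>
  h hy hy' hx hx' hz hz' (neg_le_neg_iff.1 hzy) (neg_le_neg_iff.1 hxz)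

namespace Realizes

variable {F : Finset (ℕ × ℕ)} {p q : ℕ} {v : ℕ → ℤ}

theorem neg (h : Realizes F p q v) : Realizes F p q (-v) where
  injOn := fun x hx y hy hxy => h.injOn hx hy (neg_inj.1 hxy)
  isConvexBlock_iff := fun c d hc hcd hd => by
    rw [← h.isConvexBlock_iff c d hc hcd hd]
    exact ⟨fun h => by simpa only [neg_neg] using h.neg, fun h => h.neg⟩

theorem exists_last_le_first (h : Realizes F p q v) :
    ∃ v, Realizes F p q v ∧ v (q - 1) ≤ v p := by
  rcases le_total (v (q - 1)) (v p) with hv | hv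
  · exact ⟨v, h, hv⟩
  · exact ⟨-v, h.neg, neg_le_neg hv⟩

theorem congr {F' : Finset (ℕ × ℕ)} (h : Realizes F p q v)
    (hF : ∀ c d, p ≤ c → d ≤ q → ((c, d) ∈ F' ↔ (c, d) ∈ F)) : Realizes F' p q v :=
  ⟨h.injOn, fun c d hc hcd hd => by rw [h.isConvexBlock_iff c d hc hcd hd, hF c d hc hd]⟩

end Realizes

theorem exists_mem_Ico_of_mem_Ico (t : ℕ → ℕ) {a x : ℕ} (h0 : t 0 ≤ x) (ha : x < t a) :
    ∃ i < a, t i ≤ x ∧ x < t (i + 1) := by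
  induction a with
  | zero => omega
  | succ a ih =>
    rcases Nat.lt_or_ge x (t a) with hx | hx
    · obtain ⟨i, hi, h⟩ := ih hx
      exact ⟨i, by omega, h⟩
    · exact ⟨a, a.lt_succ_self, hx, ha⟩

/-- `v` is an inflation of `π 0, …, π (a - 1)` by the sequences `w i` on `[t i, t (i + 1))`: within
each of these blocks it is ordered like `w i`, and the blocks are ordered like the entries of
`π`. -/
structure IsInflation (a : ℕ) (t : ℕ → ℕ) (π : ℕ → ℤ) (w : ℕ → ℕ → ℤ) (v : ℕ → ℤ) : Prop where
  le_iff : ∀ ⦃i x y : ℕ⦄, i < a → t i ≤ x → x < t (i + 1) → t i ≤ y → y < t (i + 1) →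
    (v x ≤ v y ↔ w i x ≤ w i y)
  lt_of_lt : ∀ ⦃i j x y : ℕ⦄, i < a → j < a → t i ≤ x → x < t (i + 1) → t j ≤ y → y < t (j + 1) →
    π i < π j → v x < v y

theorem exists_isInflation {a : ℕ} {t : ℕ → ℕ} (ht : MonotoneOn t (Set.Iic a)) (π : ℕ → ℤ)
    (w : ℕ → ℕ → ℤ) : ∃ v, IsInflation a t π w v := by
  have hindex : ∀ {i x : ℕ}, i < a → t i ≤ x → x < t (i + 1) →
      Nat.findGreatest (t · ≤ x) a = i := fun {i x} hi hx hx' =>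
    Nat.findGreatest_eq_iff.2 ⟨hi.le, fun _ => hx, fun {j} hij hj hjx =>
      (hx'.trans_le ((ht hi hj hij).trans hjx)).false⟩
  obtain ⟨M, hM⟩ : ∃ M : ℤ, ∀ i < a, ∀ x < t a, |w i x| < M := by
    obtain ⟨M, hM⟩ :=
      ((Finset.range a ×ˢ Finset.range (t a)).image fun ix => |w ix.1 ix.2|).bddAbove
    refine ⟨M + 1, fun i hi x hx => Int.lt_add_one_of_le (hM ?_)⟩
    exact Finset.mem_image_of_mem (fun ix : ℕ × ℕ => |w ix.1 ix.2|)
      (Finset.mk_mem_product (Finset.mem_range.2 hi) (Finset.mem_range.2 hx))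
  have hlt : ∀ {i x : ℕ}, i < a → x < t (i + 1) → x < t a := fun hi hx =>
    hx.trans_le (ht hi Set.self_mem_Iic hi)
  refine ⟨fun x => 2 * M * π (Nat.findGreatest (t · ≤ x) a) + w (Nat.findGreatest (t · ≤ x) a) x,
    fun i x y hi hx hx' hy hy' => ?_, fun i j x y hi hj hx hx' hy hy' hij => ?_⟩
  · rw [hindex hi hx hx', hindex hi hy hy']
    exact add_le_add_iff_left _
  · rw [hindex hi hx hx', hindex hj hy hy']
    have hwx := abs_lt.1 (hM i hi x (hlt hi hx'))
    have hwy := abs_lt.1 (hM j hj y (hlt hj hy'))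
    nlinarith

namespace IsInflation

variable {F : Finset (ℕ × ℕ)} {a : ℕ} {t : ℕ → ℕ} {π v : ℕ → ℤ} {w : ℕ → ℕ → ℤ}

theorem index_le_of_le (h : IsInflation a t π w v) {i j x y : ℕ} (hi : i < a) (hj : j < a)
    (hx : t i ≤ x) (hx' : x < t (i + 1)) (hy : t j ≤ y) (hy' : y < t (j + 1)) (hxy : v x ≤ v y) :
    π i ≤ π j :=
  le_of_not_gt fun hji => (h.lt_of_lt hj hi hy hy' hx hx' hji).not_ge hxy

theorem injOn (h : IsInflation a t π w v) (hπ : Set.InjOn π (Set.Iio a))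
    (hw : ∀ i < a, Set.InjOn (w i) (Set.Ico (t i) (t (i + 1)))) :
    Set.InjOn v (Set.Ico (t 0) (t a)) := by
  rintro x ⟨hx, hx'⟩ y ⟨hy, hy'⟩ hxy
  obtain ⟨i, hi, hix, hix'⟩ := exists_mem_Ico_of_mem_Ico t hx hx'
  obtain ⟨j, hj, hjy, hjy'⟩ := exists_mem_Ico_of_mem_Ico t hy hy'
  obtain rfl : i = j := hπ hi hj <| le_antisymm
    (h.index_le_of_le hi hj hix hix' hjy hjy' hxy.le)
    (h.index_le_of_le hj hi hjy hjy' hix hix' hxy.ge)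
  exact hw i hi ⟨hix, hix'⟩ ⟨hjy, hjy'⟩ <| le_antisymm
    ((h.le_iff hi hix hix' hjy hjy').1 hxy.le) ((h.le_iff hi hjy hjy' hix hix').1 hxy.ge)

theorem isConvexBlock_iff (h : IsInflation a t π w v) (ht : MonotoneOn t (Set.Iic a))
    (hπ : Set.InjOn π (Set.Iio a)) {i c d : ℕ} (hi : i < a) (hc : t i ≤ c) (hd : d ≤ t (i + 1)) :
    IsConvexBlock v (t 0) (t a) c d ↔ IsConvexBlock (w i) (t i) (t (i + 1)) c d := by
  have h0 : t 0 ≤ t i := ht a.zero_le hi.le i.zero_le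
  have h1 : t (i + 1) ≤ t a := ht hi Set.self_mem_Iic hi
  constructor
  · intro hcd x y z hx hx' hy hy' hz hz' hxz hzy
    exact hcd hx hx' hy hy' (h0.trans hz) (hz'.trans_le h1)
      ((h.le_iff hi (hc.trans hx) (hx'.trans_le hd) hz hz').2 hxz)
      ((h.le_iff hi hz hz' (hc.trans hy) (hy'.trans_le hd)).2 hzy)
  · intro hcd x y z hx hx' hy hy' hz hz' hxz hzy
    obtain ⟨j, hj, hjz, hjz'⟩ := exists_mem_Ico_of_mem_Ico t hz hz'
    have hx1 : t i ≤ x := hc.trans hx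
    have hx2 : x < t (i + 1) := hx'.trans_le hd
    have hy1 : t i ≤ y := hc.trans hy
    have hy2 : y < t (i + 1) := hy'.trans_le hd
    obtain rfl : i = j := hπ hi hj <| le_antisymm
      (h.index_le_of_le hi hj hx1 hx2 hjz hjz' hxz) (h.index_le_of_le hj hi hjz hjz' hy1 hy2 hzy)
    exact hcd hx hx' hy hy' hjz hjz' ((h.le_iff hi hx1 hx2 hjz hjz').1 hxz)
      ((h.le_iff hi hjz hjz' hy1 hy2).1 hzy)

theorem realizes (h : IsInflation a t π w v) (ha : 2 ≤ a) (ht : StrictMonoOn t (Set.Iic a))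
    (hπ : Set.InjOn π (Set.Iio a)) (hw : ∀ i < a, Realizes F (t i) (t (i + 1)) (w i))
    (hF : ∀ c d, (c, d) ∈ F → ∀ i ≤ a, t i ≤ c ∨ d ≤ t i)
    (hcross : ∀ c d i, t 0 ≤ c → d ≤ t a → i < a → c < t i → t i < d →
      IsConvexBlock v (t 0) (t a) c d → c = t 0 ∧ d = t a) :
    Realizes (insert (t 0, t a) F) (t 0) (t a) v := by
  refine ⟨h.injOn hπ fun i hi => (hw i hi).injOn, fun c d hc hcd hd => ?_⟩
  obtain ⟨i, hi, hic, hic'⟩ := exists_mem_Ico_of_mem_Ico t hc (hcd.trans_le hd)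
  rw [Finset.mem_insert, Prod.mk.injEq]
  rcases le_or_gt d (t (i + 1)) with hdi | hdi
  · have hne : ¬(c = t 0 ∧ d = t a) := by
      rintro ⟨rfl, rfl⟩
      have hi0 : i ≤ 0 := (ht.le_iff_le hi.le a.zero_le).1 hic
      have hia : a ≤ i + 1 := (ht.le_iff_le Set.self_mem_Iic hi).1 hdi
      omega
    rw [h.isConvexBlock_iff ht.monotoneOn hπ hi hic hdi,
      (hw i hi).isConvexBlock_iff c d hic hcd hdi, or_iff_right hne]
  · have hia : i + 1 < a := (ht.lt_iff_lt hi Set.self_mem_Iic).1 (hdi.trans_le hd)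
    constructor
    · exact fun hconv => Or.inl (hcross c d (i + 1) hc hd hia hic' hdi hconv)
    · rintro (⟨rfl, rfl⟩ | hmem)
      · exact isConvexBlock_self v _ _
      · exact ((hF c d hmem (i + 1) hi).elim hic'.not_ge hdi.not_ge).elim

theorem mem_of_lt_of_lt (h : IsInflation a t π w v) (ht : StrictMonoOn t (Set.Iic a))
    {c d i j x y z u : ℕ} (hconv : IsConvexBlock v (t 0) (t a) c d) (hcd : c < d)
    (hci : c < t (i + 1)) (hja : j < a) (hjd : t j < d) (hx : i ≤ x ∧ x < j + 1)
    (hy : i ≤ y ∧ y < j + 1) (hz : z < a) (hxz : π x < π z) (hzy : π z < π y) (hu : t z ≤ u)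
    (hu' : u < t (z + 1)) : c ≤ u ∧ u < d := by
  -- `max c (t k)` is a position of `[c, d)` in the `k`-th block.
  have hrep : ∀ k, i ≤ k ∧ k < j + 1 → max c (t k) < d ∧ max c (t k) < t (k + 1) := by
    intro k hk
    have hka : k < a := by omega
    have h1 : t k ≤ t j := ht.monotoneOn hka.le hja.le (by omega)
    have h2 : t (i + 1) ≤ t (k + 1) := ht.monotoneOn (Set.mem_Iic.2 (by omega)) hka (by omega)
    have h3 : t k < t (k + 1) := ht hka.le hka k.lt_succ_self
    omega
  have hz0 : t 0 ≤ t z := ht.monotoneOn a.zero_le hz.le z.zero_le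
  have hza : t (z + 1) ≤ t a := ht.monotoneOn hz Set.self_mem_Iic hz
  exact hconv (le_max_left c (t x)) (hrep x hx).1 (le_max_left c (t y)) (hrep y hy).1
    (hz0.trans hu) (hu'.trans_le hza)
    (h.lt_of_lt (by omega) hz (le_max_right _ _) (hrep x hx).2 hu hu' hxz).le
    (h.lt_of_lt hz (by omega) hu hu' (le_max_right _ _) (hrep y hy).2 hzy).le

end IsInflation

/-- The permutation which is order isomorphic to `π 0, …, π (a - 1)` is simple: it has no interval
other than the singletons and the whole. -/
structure IsSimple (a : ℕ) (π : ℕ → ℤ) : Prop where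
  injOn : Set.InjOn π (Set.Iio a)
  eq_of_isConvexBlock : ∀ ⦃i j : ℕ⦄, i + 1 < j → j ≤ a → IsConvexBlock π 0 a i j → i = 0 ∧ j = a

namespace IsSimple

variable {a : ℕ} {π : ℕ → ℤ}

theorem exists_lt_lt (hπ : IsSimple a π) {i j : ℕ} (hij : i + 1 < j) (hj : j ≤ a)
    (h : ¬(i = 0 ∧ j = a)) : ∃ x y z, (i ≤ x ∧ x < j) ∧ (i ≤ y ∧ y < j) ∧ z < a ∧ ¬(i ≤ z ∧ z < j) ∧
      π x < π z ∧ π z < π y := by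
  have hnot := mt (hπ.eq_of_isConvexBlock hij hj) h
  rw [IsConvexBlock] at hnot
  push Not at hnot
  obtain ⟨x, y, z, hx, hx', hy, hy', -, hz, hxz, hzy, hzij⟩ := hnot
  have hz' : ¬(i ≤ z ∧ z < j) := fun h => (hzij h.1).not_gt h.2
  refine ⟨x, y, z, ⟨hx, hx'⟩, ⟨hy, hy'⟩, hz, hz', hxz.lt_of_ne fun h => ?_,
    hzy.lt_of_ne fun h => ?_⟩
  · exact hz' (hπ.injOn (hx'.trans_le hj) hz h ▸ ⟨hx, hx'⟩)
  · exact hz' (hπ.injOn hz (hy'.trans_le hj) h ▸ ⟨hy, hy'⟩)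

end IsSimple

theorem IsInflation.eq_of_isSimple {a c d i : ℕ} {t : ℕ → ℕ} {π v : ℕ → ℤ} {w : ℕ → ℕ → ℤ}
    (h : IsInflation a t π w v) (ha : 3 ≤ a) (ht : StrictMonoOn t (Set.Iic a)) (hπ : IsSimple a π)
    (hc : t 0 ≤ c) (hd : d ≤ t a) (hi : i < a) (hci : c < t i) (hid : t i < d)
    (hconv : IsConvexBlock v (t 0) (t a) c d) : c = t 0 ∧ d = t a := by
  obtain ⟨k, hk, hkc, hkc'⟩ := exists_mem_Ico_of_mem_Ico t hc (by omega : c < t a)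
  obtain ⟨l, hl, hld, hld'⟩ :=
    exists_mem_Ico_of_mem_Ico t (a := a) (by omega : t 0 ≤ d - 1) (by omega)
  have hki : k < i := (ht.lt_iff_lt hk.le hi.le).1 (by omega)
  have hil : i < l + 1 := (ht.lt_iff_lt hi.le hl).1 (by omega : t i < t (l + 1))
  -- `[c, d)` meets the blocks `k, …, l`, which are at least two, so simplicity yields an entry of
  -- `π` in between unless these are all blocks.
  have htop : k = 0 ∧ l + 1 = a := by
    by_contra hne
    obtain ⟨x, y, z, hx, hy, hz, hz', hxz, hzy⟩ :=
      hπ.exists_lt_lt (i := k) (j := l + 1) (by omega) hl hne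
    have hz1 : t z < t (z + 1) := ht hz.le hz z.lt_succ_self
    have hcz := h.mem_of_lt_of_lt ht hconv (by omega) hkc' hl (by omega) hx hy hz hxz hzy le_rfl hz1
    have hkz : k < z + 1 := (ht.lt_iff_lt hk.le hz).1 (by omega : t k < t (z + 1))
    have hzl : z < l + 1 := (ht.lt_iff_lt hz.le hl).1 (by omega : t z < t (l + 1))
    omega
  obtain ⟨rfl, rfl⟩ := htop
  -- The first entry of `π` lies between two others, so `[c, d)` contains all of the first block,
  -- and likewise all of the last one.
  constructor
  · obtain ⟨x, y, z, hx, hy, hz, hz', hxz, hzy⟩ :=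
      hπ.exists_lt_lt (i := 1) (j := l + 1) (by omega) le_rfl (by omega)
    obtain rfl : z = 0 := by omega
    have hmem := h.mem_of_lt_of_lt ht hconv (by omega) hkc' hl (by omega) (x := x) (y := y)
      (by omega) (by omega) hz hxz hzy le_rfl (by omega)
    omega
  · obtain ⟨x, y, z, hx, hy, hz, hz', hxz, hzy⟩ :=
      hπ.exists_lt_lt (i := 0) (j := l) (by omega) (by omega) (by omega)
    obtain rfl : z = l := by omega
    have hmem := h.mem_of_lt_of_lt ht hconv (by omega) hkc' hl (by omega) (x := x) (y := y)
      (u := t (z + 1) - 1) (by omega) (by omega) hz hxz hzy (by omega) (by omega)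
    omega

theorem IsInflation.eq_of_last_le_first {c d : ℕ} {t : ℕ → ℕ} {v : ℕ → ℤ} {w : ℕ → ℕ → ℤ}
    (h : IsInflation 2 t (fun i => (i : ℤ)) w v)
    (hw : ∀ i < 2, w i (t (i + 1) - 1) ≤ w i (t i)) (hc : t 0 ≤ c) (hd : d ≤ t 2) (hci : c < t 1)
    (hid : t 1 < d) (hconv : IsConvexBlock v (t 0) (t 2) c d) : c = t 0 ∧ d = t 2 := by
  have hlt : ∀ {x y}, t 0 ≤ x → x < t 1 → t 1 ≤ y → y < t 2 → v x < v y :=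
    fun hx hx' hy hy' => h.lt_of_lt two_pos one_lt_two hx hx' hy hy' zero_lt_one
  have h01 : v (t 1 - 1) ≤ v (t 0) :=
    (h.le_iff two_pos (by omega) (by simp; omega) le_rfl (by simp; omega)).2 (hw 0 two_pos)
  have h12 : v (t 2 - 1) ≤ v (t 1) :=
    (h.le_iff one_lt_two (by omega) (by simp; omega) le_rfl (by simp; omega)).2 (hw 1 one_lt_two)
  -- `v (t 1 - 1) ≤ v (t 0) < v (t 1)` and `v (t 1 - 1) < v (t 2 - 1) ≤ v (t 1)`, where the outer
  -- positions `t 1 - 1` and `t 1` belong to `[c, d)`.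
  have hfirst := hconv (x := t 1 - 1) (y := t 1) (z := t 0) (by omega) (by omega) (by omega) hid
    le_rfl (by omega) h01 (hlt le_rfl (by omega) le_rfl (by omega)).le
  have hlast := hconv (x := t 1 - 1) (y := t 1) (z := t 2 - 1) (by omega) (by omega) (by omega) hid
    (by omega) (by omega) (hlt (by omega) (by omega) (by omega) (by omega)).le h12
  omega

/-- The sequence `1, -1, 2, -2, …, 0` of length `a`. -/
def alternatingSeq (a i : ℕ) : ℤ :=
  if i + 1 = a then 0 else if i % 2 = 0 then (i / 2 : ℕ) + 1 else -((i / 2 : ℕ) + 1)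

theorem one_le_alternatingSeq {a i : ℕ} (hi : i + 1 < a) (hi2 : i % 2 = 0) :
    1 ≤ alternatingSeq a i := by
  rw [alternatingSeq, if_neg hi.ne, if_pos hi2]
  omega

theorem alternatingSeq_le_neg_one {a i : ℕ} (hi : i + 1 < a) (hi2 : i % 2 = 1) :
    alternatingSeq a i ≤ -1 := by
  rw [alternatingSeq, if_neg hi.ne, if_neg (by omega)]
  omega

theorem isSimple_alternatingSeq {a : ℕ} (ha : 4 ≤ a) : IsSimple a (alternatingSeq a) where
  injOn i hi j hj h := by
    rw [Set.mem_Iio] at hi hj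
    unfold alternatingSeq at h
    split_ifs at h <;> omega
  eq_of_isConvexBlock i j hij hj h := by
    have hlast : alternatingSeq a (a - 1) = 0 := if_pos (by omega)
    -- Two neighbours have opposite signs, so the final `0` lies between them.
    have hja : j = a := by
      by_contra hne
      rcases Nat.mod_two_eq_zero_or_one i with hi | hi
      · have := one_le_alternatingSeq (i := i) (a := a) (by omega) hi
        have := alternatingSeq_le_neg_one (i := i + 1) (a := a) (by omega) (by omega)
        have := @h (i + 1) i (a - 1)
        omega
      · have := alternatingSeq_le_neg_one (i := i) (a := a) (by omega) hi
        have := one_le_alternatingSeq (i := i + 1) (a := a) (by omega) (by omega)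
        have := @h i (i + 1) (a - 1)
        omega
    have hfirst : ∀ x, i ≤ x → x + 1 < a → x % 2 = 0 → i = 0 := by
      intro x hix hxa hx
      have h0 : alternatingSeq a 0 = 1 := by
        rw [alternatingSeq, if_neg (by omega), if_pos rfl]
        rfl
      have := one_le_alternatingSeq hxa hx
      have := @h (a - 1) x 0
      omega
    refine ⟨?_, hja⟩
    rcases Nat.mod_two_eq_zero_or_one (a - 2) with ha2 | ha2
    · exact hfirst (a - 2) (by omega) (by omega) ha2
    · have h1 : alternatingSeq a 1 = -1 := by
        rw [alternatingSeq, if_neg (by omega), if_neg (by norm_num)]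
        rfl
      have := alternatingSeq_le_neg_one (i := a - 2) (a := a) (by omega) ha2
      have := @h (a - 2) (a - 1) 1
      exact hfirst 2 (by omega) (by omega) rfl

theorem exists_realizes_insert {F : Finset (ℕ × ℕ)} {a : ℕ} {t : ℕ → ℕ} (ha : 2 ≤ a) (ha3 : a ≠ 3)
    (ht : StrictMonoOn t (Set.Iic a)) (hF : ∀ c d, (c, d) ∈ F → ∀ i ≤ a, t i ≤ c ∨ d ≤ t i)
    (hw : ∀ i < a, ∃ w, Realizes F (t i) (t (i + 1)) w) :
    ∃ v, Realizes (insert (t 0, t a) F) (t 0) (t a) v := by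
  rcases ha.eq_or_lt with rfl | ha2
  · choose! w hw hlast using fun i hi => (hw i hi).elim fun _ h => h.exists_last_le_first
    obtain ⟨v, hv⟩ := exists_isInflation ht.monotoneOn (fun i => (i : ℤ)) w
    refine ⟨v, hv.realizes le_rfl ht Nat.cast_injective.injOn hw hF ?_⟩
    intro c d i hc hd hi hci hid hconv
    obtain rfl : i = 1 := by
      have hi0 : i ≠ 0 := by
        rintro rfl
        exact hci.not_ge hc
      omega
    exact hv.eq_of_last_le_first hlast hc hd hci hid hconv
  · choose! w hw using hw
    have hπ := isSimple_alternatingSeq (by omega : 4 ≤ a)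
    obtain ⟨v, hv⟩ := exists_isInflation ht.monotoneOn (alternatingSeq a) w
    exact ⟨v, hv.realizes ha ht hπ.injOn hw hF fun c d i hc hd hi hci hid hconv =>
      hv.eq_of_isSimple ha2 ht hπ hc hd hi hci hid hconv⟩

theorem PlaneForest.exists_realizes {A : Set ℕ} (hA : 3 ∉ A) {m n : ℕ} (f : PlaneForest A m n)
    {i : ℕ} (hi : i < m) : ∃ v, Realizes f.blocks (f.cut i) (f.cut (i + 1)) v := by
  induction f generalizing i with
  | nil => omega
  | @leaf m n f ih =>
    rcases Nat.lt_succ_iff_lt_or_eq.1 hi with hi | rfl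
    · obtain ⟨v, hv⟩ := ih hi
      rw [cut_leaf_of_le f hi.le, cut_leaf_of_le f hi]
      refine ⟨v, hv.congr fun c d _ hd => ?_⟩
      have hdn : d ≠ n + 1 := by
        have := f.cut_self ▸ f.cut_le_cut (i := i + 1) hi le_rfl
        omega
      simp [blocks, hdn]
    · rw [cut_leaf_of_le f le_rfl, cut_self, cut_self]
      refine ⟨fun _ => 0, fun x hx y hy _ => ?_, fun c d hc hcd hd => ?_⟩
      · rw [Set.mem_Ico] at hx hy
        omega
      · obtain ⟨rfl, rfl⟩ : c = n ∧ d = n + 1 := by omega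
        exact iff_of_true (isConvexBlock_self _ _ _) (Finset.mem_insert_self _ _)
  | @node m n e he f ih =>
    rcases Nat.lt_succ_iff_lt_or_eq.1 hi with hi | rfl
    · obtain ⟨v, hv⟩ := ih (by omega : i < m + e + 2)
      rw [cut_node_of_le he f hi.le, cut_node_of_le he f hi]
      refine ⟨v, hv.congr fun c d _ hd => ?_⟩
      have hdn : d ≠ n := by
        have := f.cut_lt (by omega : m < m + e + 2)
        have := f.cut_le_cut (i := i + 1) (j := m) hi (by omega)
        omega
      simp [blocks, hdn]
    · have ht : StrictMonoOn (fun j => f.cut (i + j)) (Set.Iic (e + 2)) := fun j hj k hk hjk =>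
        f.strictMonoOn_cut (Set.mem_Iic.2 (by simp at hj; omega))
          (Set.mem_Iic.2 (by simp at hk; omega)) (by omega)
      obtain ⟨v, hv⟩ := exists_realizes_insert (F := f.blocks) (by omega)
        (fun h3 : e + 2 = 3 => hA (h3 ▸ he)) ht
        (fun c d h j hj => f.cut_le_or_le_cut h (by omega)) fun j hj => ih (by omega)
      refine ⟨v, ?_⟩
      rw [cut_node_of_le he f le_rfl, cut_self]
      simpa only [blocks, add_zero, ← add_assoc, cut_self] using hv

/-! ### Forests from laminar families -/

/-- The points `t 0 < ⋯ < t a` divide the block `[t 0, t a)` of the family `G` into its children,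
the maximal members of `G` that it properly contains. -/
structure IsChildDecomposition (G : Finset (ℕ × ℕ)) (a : ℕ) (t : ℕ → ℕ) : Prop where
  mem : (t 0, t a) ∈ G
  mem_succ : ∀ i < a, (t i, t (i + 1)) ∈ G
  eq_of_mem : ∀ ⦃i j : ℕ⦄, i < j → j ≤ a → (t i, t j) ∈ G → j = i + 1 ∨ i = 0 ∧ j = a

theorem IsLaminar.mono {G H : Finset (ℕ × ℕ)} (hG : IsLaminar G) (h : H ⊆ G) : IsLaminar H :=
  fun _ _ _ _ hc hc' => hG (h hc) (h hc')

theorem IsChildDecomposition.of_erase {G : Finset (ℕ × ℕ)} {a c n : ℕ} {t : ℕ → ℕ}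
    (h : IsChildDecomposition (G.erase (c, n)) a t) (hlt : ∀ b d, (b, d) ∈ G → b < d ∧ d ≤ n)
    (hmin : ∀ b, (b, n) ∈ G → c ≤ b) : IsChildDecomposition G a t where
  mem := Finset.mem_of_mem_erase h.mem
  mem_succ i hi := Finset.mem_of_mem_erase (h.mem_succ i hi)
  eq_of_mem i j hij hj hG := by
    refine h.eq_of_mem hij hj (Finset.mem_erase.2 ⟨fun heq => ?_, hG⟩)
    obtain ⟨rfl, rfl⟩ := Prod.mk.inj heq
    have ht : StrictMonoOn t (Set.Iic a) := strictMonoOn_Iic_of_lt_succ fun k hk =>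
      (hlt _ _ (Finset.mem_of_mem_erase (h.mem_succ k hk))).1
    obtain ⟨hne, hmem⟩ := Finset.mem_erase.1 h.mem
    have htj : t a = t j :=
      (hlt _ _ hmem).2.antisymm (ht.monotoneOn (Set.mem_Iic.2 hj) Set.self_mem_Iic hj)
    have hti : t 0 = t i := (ht.monotoneOn a.zero_le (hij.le.trans hj) i.zero_le).antisymm
      (hmin _ (htj ▸ hmem))
    exact hne (by rw [htj, hti])

namespace PlaneForest

variable {A : Set ℕ} {m n : ℕ}

theorem eq_of_mk_cut_mem_blocks (f : PlaneForest A m n) {i j : ℕ} (hij : i < j) (hj : j ≤ m)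
    (h : (f.cut i, f.cut j) ∈ f.blocks) : j = i + 1 := by
  by_contra hne
  have h1 := f.cut_lt_cut_succ (i := i) (by omega)
  have h2 := f.strictMonoOn_cut (Set.mem_Iic.2 (by omega : i + 1 ≤ m)) hj (by omega)
  exact (f.cut_le_or_le_cut h (i := i + 1) (by omega)).elim h1.not_ge h2.not_ge

theorem exists_cut_eq {G : Finset (ℕ × ℕ)} {c : ℕ} (f : PlaneForest A m n) (hG : IsLaminar G)
    (hf : f.blocks ⊆ G) (hcG : (c, n) ∈ G) (hcn : c < n) (hmin : ∀ b, (b, n) ∈ G → c ≤ b) :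
    ∃ i < m, f.cut i = c := by
  obtain ⟨i, hi, hic, hic'⟩ :=
    exists_mem_Ico_of_mem_Ico f.cut (a := m) (f.cut_zero ▸ c.zero_le) (f.cut_self.symm ▸ hcn)
  refine ⟨i, hi, hic.antisymm (le_of_not_gt fun hlt => ?_)⟩
  have hmem := hf (f.mk_cut_mem_blocks hi)
  have hcut : f.cut (i + 1) = n :=
    (f.cut_self ▸ f.cut_le_cut (i := i + 1) hi le_rfl).antisymm (hG hmem hcG hlt hic')
  rw [hcut] at hmem
  exact (hmin _ hmem).not_gt hlt

theorem exists_blocks_eq_of_erase {G : Finset (ℕ × ℕ)} {c : ℕ} (f : PlaneForest A m n)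
    (hf : f.blocks = G.erase (c, n)) (hG : IsLaminar G) (hcG : (c, n) ∈ G) (hcn : c < n)
    (hmin : ∀ b, (b, n) ∈ G → c ≤ b)
    (hA : ∀ a t, 2 ≤ a → IsChildDecomposition G a t → a ∈ A) :
    ∃ m', ∃ g : PlaneForest A m' n, g.blocks = G := by
  have hfG : f.blocks ⊆ G := hf ▸ G.erase_subset _
  obtain ⟨i, hi, rfl⟩ := f.exists_cut_eq hG hfG hcG hcn hmin
  obtain ⟨k, rfl⟩ : ∃ k, m = i + k := ⟨m - i, by omega⟩
  have hne : k ≠ 1 := by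
    rintro rfl
    have hmem := f.mk_cut_mem_blocks hi
    rw [f.cut_self, hf] at hmem
    exact Finset.notMem_erase _ _ hmem
  obtain ⟨e, rfl⟩ : ∃ e, k = e + 2 := ⟨k - 2, by omega⟩
  have hdec : IsChildDecomposition G (e + 2) fun j => f.cut (i + j) := by
    refine ⟨f.cut_self.symm ▸ hcG, fun j hj => hfG (f.mk_cut_mem_blocks (by omega)),
      fun j l hjl hl hmem => ?_⟩
    by_cases heq : (f.cut (i + j), f.cut (i + l)) = (f.cut i, n)
    · obtain ⟨hj, hl'⟩ := Prod.mk.inj heq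
      have := f.strictMonoOn_cut.injOn (Set.mem_Iic.2 (by omega)) (Set.mem_Iic.2 (by omega)) hj
      have := f.strictMonoOn_cut.injOn (Set.mem_Iic.2 (by omega)) Set.self_mem_Iic
        (hl'.trans f.cut_self.symm)
      omega
    · have := f.eq_of_mk_cut_mem_blocks (by omega) (by omega)
        (hf ▸ Finset.mem_erase.2 ⟨heq, hmem⟩)
      omega
  exact ⟨i + 1, f.node e (hA _ _ (by omega) hdec), by rw [blocks, hf, Finset.insert_erase hcG]⟩

theorem exists_blocks_eq {G : Finset (ℕ × ℕ)} (hlt : ∀ c d, (c, d) ∈ G → c < d ∧ d ≤ n)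
    (hsing : ∀ i < n, (i, i + 1) ∈ G) (hG : IsLaminar G)
    (hA : ∀ a t, 2 ≤ a → IsChildDecomposition G a t → a ∈ A) :
    ∃ m, ∃ f : PlaneForest A m n, f.blocks = G := by
  induction hk : G.card using Nat.strong_induction_on generalizing n G with
  | h k ih =>
  subst hk
  cases n with
  | zero =>
    refine ⟨0, nil, (Finset.eq_empty_of_forall_notMem ?_).symm⟩
    rintro ⟨c, d⟩ h
    have := hlt c d h
    omega
  | succ n =>
    have hlast : ∃ c, (c, n + 1) ∈ G := ⟨n, hsing n n.lt_succ_self⟩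
    obtain ⟨c, hc, hmin⟩ : ∃ c, (c, n + 1) ∈ G ∧ ∀ b, (b, n + 1) ∈ G → c ≤ b :=
      ⟨Nat.find hlast, Nat.find_spec hlast, fun b hb => Nat.find_min' hlast hb⟩
    have hcn : c < n + 1 := (hlt c _ hc).1
    have hcard := Finset.card_erase_lt_of_mem hc
    have hsub := G.erase_subset (c, n + 1)
    have hA' : ∀ a t, 2 ≤ a → IsChildDecomposition (G.erase (c, n + 1)) a t → a ∈ A :=
      fun a t ha h => hA a t ha (h.of_erase hlt hmin)
    rcases Nat.lt_succ_iff_lt_or_eq.1 hcn with hcn' | rfl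
    · obtain ⟨m, f, hf⟩ := ih _ hcard (n := n + 1) (fun b d h => hlt b d (hsub h))
        (fun i hi => Finset.mem_erase.2 ⟨by simp; omega, hsing i hi⟩) (hG.mono hsub) hA' rfl
      exact f.exists_blocks_eq_of_erase hf hG hc hcn hmin hA
    · have hlt' : ∀ b d, (b, d) ∈ G.erase (c, c + 1) → b < d ∧ d ≤ c := fun b d h => by
        obtain ⟨hne, hmem⟩ := Finset.mem_erase.1 h
        obtain ⟨hbd, hd⟩ := hlt b d hmem
        refine ⟨hbd, Nat.le_of_lt_succ (hd.lt_of_ne ?_)⟩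
        rintro rfl
        exact hne (by rw [(hmin b hmem).antisymm (Nat.le_of_lt_succ hbd)])
      obtain ⟨m, f, hf⟩ := ih _ hcard (n := c) hlt'
        (fun i hi => Finset.mem_erase.2 ⟨by simp; omega, hsing i (by omega)⟩) (hG.mono hsub) hA' rfl
      exact ⟨m + 1, f.leaf, by rw [blocks, hf, Finset.insert_erase hc]⟩

theorem eq_one_of_mem_blocks (f : PlaneForest A m n) (h : (0, n) ∈ f.blocks) : m = 1 := by
  have hn : 0 < n := (f.lt_and_le_of_mem_blocks h).1
  have hm : m ≠ 0 := by
    rintro rfl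
    exact hn.ne (f.cut_zero.symm.trans f.cut_self)
  by_contra hne
  have h1 : 0 < f.cut 1 := f.cut_zero ▸ f.cut_lt_cut_succ (i := 0) (by omega)
  exact (f.cut_le_or_le_cut h (i := 1) (by omega)).elim h1.not_ge (f.cut_lt (by omega)).not_ge

end PlaneForest

section ConvexBlocks

variable {α : Type*} [LinearOrder α] {v : ℕ → α} {p q c e f d : ℕ}

theorem IsConvexBlock.lt_of_le (h : IsConvexBlock v p q c d) {x y z : ℕ} (hx : c ≤ x ∧ x < d)
    (hy : c ≤ y ∧ y < d) (hz : p ≤ z ∧ z < q) (hout : ¬(c ≤ z ∧ z < d)) (hxz : v x ≤ v z) :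
    v y < v z :=
  lt_of_not_ge fun hzy => hout (h hx.1 hx.2 hy.1 hy.2 hz.1 hz.2 hxz hzy)

theorem IsConvexBlock.lt_of_ge (h : IsConvexBlock v p q c d) {x y z : ℕ} (hx : c ≤ x ∧ x < d)
    (hy : c ≤ y ∧ y < d) (hz : p ≤ z ∧ z < q) (hout : ¬(c ≤ z ∧ z < d)) (hzx : v z ≤ v x) :
    v z < v y :=
  lt_of_not_ge fun hyz => hout (h hy.1 hy.2 hx.1 hx.2 hz.1 hz.2 hyz hzx)

theorem IsConvexBlock.exists_between (hce : IsConvexBlock v p q c e)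
    (hef : IsConvexBlock v p q e f) (hc : c < e) (he : e < f) (h : ¬IsConvexBlock v p q c f) :
    ∃ z, (p ≤ z ∧ z < q) ∧ ¬(c ≤ z ∧ z < f) ∧ (v c < v z ∧ v z < v e ∨ v e < v z ∧ v z < v c) := by
  rw [IsConvexBlock] at h
  push Not at h
  obtain ⟨x, y, z, hx, hx', hy, hy', hz, hz', hxz, hzy, hout⟩ := h
  have hout_l : ¬(c ≤ z ∧ z < e) := fun h => (hout h.1).not_gt (h.2.trans he)
  have hout_r : ¬(e ≤ z ∧ z < f) := fun h => (hout (hc.le.trans h.1)).not_gt h.2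
  have hlt_c {x} (hx : c ≤ x ∧ x < e) := hce.lt_of_le hx ⟨le_rfl, hc⟩ ⟨hz, hz'⟩ hout_l
  have hc_lt {x} (hx : c ≤ x ∧ x < e) := hce.lt_of_ge hx ⟨le_rfl, hc⟩ ⟨hz, hz'⟩ hout_l
  have hlt_e {x} (hx : e ≤ x ∧ x < f) := hef.lt_of_le hx ⟨le_rfl, he⟩ ⟨hz, hz'⟩ hout_r
  have he_lt {x} (hx : e ≤ x ∧ x < f) := hef.lt_of_ge hx ⟨le_rfl, he⟩ ⟨hz, hz'⟩ hout_r
  refine ⟨z, ⟨hz, hz'⟩, fun h => (hout h.1).not_gt h.2, ?_⟩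
  rcases Nat.lt_or_ge x e with hxe | hxe <;> rcases Nat.lt_or_ge y e with hye | hye
  · exact ((hlt_c ⟨hx, hxe⟩ hxz).not_gt (hc_lt ⟨hy, hye⟩ hzy)).elim
  · exact Or.inl ⟨hlt_c ⟨hx, hxe⟩ hxz, he_lt ⟨hye, hy'⟩ hzy⟩
  · exact Or.inr ⟨hlt_e ⟨hxe, hx'⟩ hxz, hc_lt ⟨hy, hye⟩ hzy⟩
  · exact ((hlt_e ⟨hxe, hx'⟩ hxz).not_gt (he_lt ⟨hye, hy'⟩ hzy)).elim

theorem IsConvexBlock.mem_of_between (h : IsConvexBlock v p q c d) {x y z : ℕ}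
    (hx : c ≤ x ∧ x < d) (hy : c ≤ y ∧ y < d) (hz : p ≤ z ∧ z < q)
    (hbet : v x < v z ∧ v z < v y ∨ v y < v z ∧ v z < v x) : c ≤ z ∧ z < d :=
  hbet.elim (fun hxy => h hx.1 hx.2 hy.1 hy.2 hz.1 hz.2 hxy.1.le hxy.2.le)
    fun hyx => h hy.1 hy.2 hx.1 hx.2 hz.1 hz.2 hyx.1.le hyx.2.le

theorem IsConvexBlock.union_or_union (hce : IsConvexBlock v p q c e)
    (hef : IsConvexBlock v p q e f) (hfd : IsConvexBlock v p q f d) (hcd : IsConvexBlock v p q c d)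
    (hc : c < e) (he : e < f) (hf : f < d) :
    IsConvexBlock v p q c f ∨ IsConvexBlock v p q e d := by
  -- Otherwise the last block has values between those of the first two, and the first block has
  -- values between those of the last two.
  by_contra! hnot
  obtain ⟨z, hz, hout, hbet⟩ := hce.exists_between hef hc he hnot.1
  obtain ⟨x, hx, hout', hbet'⟩ := hef.exists_between hfd he hf hnot.2
  have hzK : f ≤ z ∧ z < d := by
    have := hcd.mem_of_between (x := c) (y := e) (by omega) (by omega) hz hbet
    omega
  have hxI : c ≤ x ∧ x < e := by
    have := hcd.mem_of_between (x := e) (y := f) (by omega) (by omega) hx hbet'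
    omega
  have hzI : ¬(c ≤ z ∧ z < e) := by omega
  have hxK : ¬(f ≤ x ∧ x < d) := by omega
  rcases hbet with ⟨hcz, hze⟩ | ⟨hez, hzc⟩
  · have hxz := hce.lt_of_le ⟨le_rfl, hc⟩ hxI hz hzI hcz.le
    have hxf := hfd.lt_of_ge hzK ⟨le_rfl, hf⟩ hx hxK hxz.le
    rcases hbet' with h | h <;> order
  · have hzx := hce.lt_of_ge ⟨le_rfl, hc⟩ hxI hz hzI hzc.le
    have hfx := hfd.lt_of_le hzK ⟨le_rfl, hf⟩ hx hxK hzx.le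
    rcases hbet' with h | h <;> order

end ConvexBlocks

/-! ### Intervals of sequences and permutations -/

section ConvexBlocks

variable {α : Type*} {v : ℕ → α} {n : ℕ}

open Classical in
/-- The blocks of positions in `[0, n)` on which `v` takes consecutive values: the intervals of the
sequence `v 0, …, v (n - 1)`. -/
noncomputable def convexBlocks [LE α] (n : ℕ) (v : ℕ → α) : Finset (ℕ × ℕ) :=
  {p ∈ Finset.range (n + 1) ×ˢ Finset.range (n + 1) |
    p.1 < p.2 ∧ IsConvexBlock v 0 n p.1 p.2}

theorem mem_convexBlocks [LE α] {c d : ℕ} :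
    (c, d) ∈ convexBlocks n v ↔ c < d ∧ d ≤ n ∧ IsConvexBlock v 0 n c d := by
  simp only [convexBlocks, Finset.mem_filter, Finset.mem_product, Finset.mem_range]
  grind

theorem convexBlocks_congr {β : Type*} [LE α] [LE β] {w : ℕ → β}
    (h : ∀ x < n, ∀ y < n, v x ≤ v y ↔ w x ≤ w y) : convexBlocks n v = convexBlocks n w := by
  ext ⟨c, d⟩
  rw [mem_convexBlocks, mem_convexBlocks]
  refine and_congr_right fun _ => and_congr_right fun hd => ?_
  constructor <;> intro hcd x y z hx hx' hy hy' hz hz' hxz hzy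
  · exact hcd hx hx' hy hy' hz hz' ((h _ (hx'.trans_le hd) _ hz').2 hxz)
      ((h _ hz' _ (hy'.trans_le hd)).2 hzy)
  · exact hcd hx hx' hy hy' hz hz' ((h _ (hx'.trans_le hd) _ hz').1 hxz)
      ((h _ hz' _ (hy'.trans_le hd)).1 hzy)

theorem mk_succ_mem_convexBlocks [PartialOrder α] (hv : Set.InjOn v (Set.Ico 0 n)) {c : ℕ}
    (hc : c < n) : (c, c + 1) ∈ convexBlocks n v := by
  refine mem_convexBlocks.2 ⟨c.lt_succ_self, hc, fun x y z hx hx' hy hy' hz hz' hxz hzy => ?_⟩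
  obtain rfl : x = c := by omega
  obtain rfl : y = x := by omega
  obtain rfl := hv ⟨hz, hz'⟩ ⟨Nat.zero_le _, hc⟩ (hzy.antisymm hxz)
  exact ⟨le_rfl, hx'⟩

theorem zero_mem_convexBlocks [LE α] (hn : 0 < n) : (0, n) ∈ convexBlocks n v :=
  mem_convexBlocks.2 ⟨hn, le_rfl, isConvexBlock_self v 0 n⟩

theorem ne_three_of_isChildDecomposition_convexBlocks [LinearOrder α] {a : ℕ} {t : ℕ → ℕ}
    (h : IsChildDecomposition (convexBlocks n v) a t) : a ≠ 3 := by
  rintro rfl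
  obtain ⟨-, h3, h03⟩ := mem_convexBlocks.1 h.mem
  obtain ⟨h0, -, h01⟩ := mem_convexBlocks.1 (h.mem_succ 0 (by norm_num))
  obtain ⟨h1, -, h12⟩ := mem_convexBlocks.1 (h.mem_succ 1 (by norm_num))
  obtain ⟨h2, -, h23⟩ := mem_convexBlocks.1 (h.mem_succ 2 (by norm_num))
  rcases h01.union_or_union h12 h23 h03 h0 h1 h2 with h02 | h13
  · have := h.eq_of_mem (i := 0) (j := 2) (by norm_num) (by norm_num)
      (mem_convexBlocks.2 ⟨h0.trans h1, h2.le.trans h3, h02⟩)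
    omega
  · have := h.eq_of_mem (i := 1) (j := 3) (by norm_num) le_rfl
      (mem_convexBlocks.2 ⟨h1.trans h2, h3, h13⟩)
    omega

theorem exists_planeForest_blocks_eq_convexBlocks [LinearOrder α] (hn : 0 < n)
    (hv : Set.InjOn v (Set.Ico 0 n)) (h : IsLaminar (convexBlocks n v)) :
    ∃ f : PlaneForest {3}ᶜ 1 n, f.blocks = convexBlocks n v := by
  obtain ⟨m, f, hf⟩ := PlaneForest.exists_blocks_eq (A := {3}ᶜ)
    (fun c d hcd => ⟨(mem_convexBlocks.1 hcd).1, (mem_convexBlocks.1 hcd).2.1⟩)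
    (fun i hi => mk_succ_mem_convexBlocks hv hi) h
    fun a t _ ht => ne_three_of_isChildDecomposition_convexBlocks ht
  obtain rfl := f.eq_one_of_mem_blocks (hf ▸ zero_mem_convexBlocks hn)
  exact ⟨f, hf⟩

theorem PlaneForest.exists_convexBlocks_eq_blocks {A : Set ℕ} (hA : 3 ∉ A)
    (f : PlaneForest A 1 n) :
    ∃ v : ℕ → ℤ, Set.InjOn v (Set.Ico 0 n) ∧ convexBlocks n v = f.blocks := by
  obtain ⟨v, hv⟩ := f.exists_realizes hA one_pos
  rw [f.cut_zero, zero_add, f.cut_self] at hv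
  refine ⟨v, hv.injOn, Finset.ext fun ⟨c, d⟩ => mem_convexBlocks.trans ⟨?_, fun h => ?_⟩⟩
  · rintro ⟨hcd, hd, h⟩
    exact (hv.isConvexBlock_iff c d c.zero_le hcd hd).1 h
  · obtain ⟨hcd, hd⟩ := f.lt_and_le_of_mem_blocks h
    exact ⟨hcd, hd, (hv.isConvexBlock_iff c d c.zero_le hcd hd).2 h⟩

end ConvexBlocks

/-- The word `σ 0, …, σ (n - 1)` of a permutation, continued by the junk value `0`. -/
def word {n : ℕ} (σ : Equiv.Perm (Fin n)) (x : ℕ) : ℕ :=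
  if h : x < n then σ ⟨x, h⟩ else 0

section Word

variable {n : ℕ} (σ : Equiv.Perm (Fin n))

theorem word_apply (i : Fin n) : word σ i = σ i :=
  dif_pos i.2

theorem word_le_iff (i j : Fin n) : word σ i ≤ word σ j ↔ σ i ≤ σ j := by
  rw [word_apply, word_apply, Fin.val_fin_le]

theorem injOn_word : Set.InjOn (word σ) (Set.Ico 0 n) := by
  rintro x ⟨-, hx⟩ y ⟨-, hy⟩ h
  have hσ : (σ ⟨x, hx⟩ : ℕ) = σ ⟨y, hy⟩ := by
    rwa [← word_apply σ ⟨x, hx⟩, ← word_apply σ ⟨y, hy⟩]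
  exact congrArg Fin.val (σ.injective (Fin.ext hσ))

theorem exists_convexBlocks_word_eq {α : Type*} [LinearOrder α] {v : ℕ → α}
    (hv : Set.InjOn v (Set.Ico 0 n)) :
    ∃ σ : Equiv.Perm (Fin n), convexBlocks n (word σ) = convexBlocks n v := by
  let f : Fin n → α := fun i => v i
  have hf : Function.Injective f := fun i j h =>
    Fin.ext (hv ⟨Nat.zero_le _, i.2⟩ ⟨Nat.zero_le _, j.2⟩ h)
  have hsort : StrictMono (f ∘ Tuple.sort f) :=
    (Tuple.monotone_sort f).strictMono_of_injective (hf.comp (Equiv.injective _))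
  refine ⟨(Tuple.sort f).symm, convexBlocks_congr fun x hx y hy => ?_⟩
  rw [word_le_iff _ ⟨x, hx⟩ ⟨y, hy⟩, ← hsort.le_iff_le]
  simp only [f, Function.comp_apply, Equiv.apply_symm_apply]

end Word

/-! ### Tree interval posets -/

section Hasse

variable {α : Type*} [PartialOrder α]

theorem connected_hasse [Finite α] [OrderTop α] : (SimpleGraph.hasse α).Connected := by
  have hreach : ∀ x : α, (SimpleGraph.hasse α).Reachable x ⊤ := by
    intro x
    induction x using WellFoundedGT.induction with
    | ind x ih =>
      rcases eq_or_ne x ⊤ with rfl | hx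
      · rfl
      · obtain ⟨y, hy⟩ := exists_covBy_of_wellFoundedLT (not_isMax_iff_ne_top.2 hx)
        exact (SimpleGraph.Adj.reachable (Or.inl hy)).trans (ih y hy.lt)
  exact { preconnected := fun x y => (hreach x).trans (hreach y).symm, nonempty := ⟨⊤⟩ }

theorem card_edgeSet_hasse :
    Nat.card (SimpleGraph.hasse α).edgeSet = Nat.card {p : α × α // p.1 ⋖ p.2} := by
  refine (Nat.card_congr (Equiv.ofBijective
    (fun p => ⟨s(p.1.1, p.1.2), Or.inl p.2⟩) ⟨?_, ?_⟩)).symm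
  · rintro ⟨⟨x, y⟩, h⟩ ⟨⟨x', y'⟩, h'⟩ heq
    rcases Sym2.eq_iff.1 (congrArg Subtype.val heq) with ⟨rfl, rfl⟩ | ⟨rfl, rfl⟩
    · rfl
    · exact absurd h.lt h'.lt.not_gt
  · rintro ⟨e, he⟩
    induction e with
    | _ x y =>
      rcases he with h | h
      · exact ⟨⟨(x, y), h⟩, rfl⟩
      · exact ⟨⟨(y, x), h⟩, Subtype.ext Sym2.eq_swap⟩

theorem isTree_hasse_iff_forall_covBy [Finite α] [OrderTop α] :
    (SimpleGraph.hasse α).IsTree ↔ ∀ x y z : α, x ⋖ y → x ⋖ z → y = z := by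
  let lower : {p : α × α // p.1 ⋖ p.2} → {x : α // x ≠ ⊤} := fun p => ⟨p.1.1, p.2.lt.ne_top⟩
  have hsurj : Function.Surjective lower := fun ⟨x, hx⟩ => by
    obtain ⟨y, hy⟩ := exists_covBy_of_wellFoundedLT (not_isMax_iff_ne_top.2 hx)
    exact ⟨⟨(x, y), hy⟩, rfl⟩
  have hcard : Nat.card α = Nat.card {x : α // x ≠ ⊤} + 1 := by
    classical
    rw [← Finite.card_option, Nat.card_congr (Equiv.optionSubtypeNe ⊤)]
  rw [SimpleGraph.isTree_iff_connected_and_card, and_iff_right connected_hasse,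
    card_edgeSet_hasse, hcard, Nat.add_right_cancel_iff]
  constructor
  · intro h x y z hy hz
    have hinj : Function.Injective lower := (hsurj.bijective_of_nat_card_le h.le).1
    have heq := @hinj ⟨(x, y), hy⟩ ⟨(x, z), hz⟩ rfl
    exact congrArg (fun p => p.1.2) heq
  · refine fun h => Nat.card_congr (Equiv.ofBijective lower ⟨?_, hsurj⟩)
    rintro ⟨⟨x, y⟩, hy⟩ ⟨⟨x', z⟩, hz⟩ heq
    obtain rfl : x = x' := congrArg Subtype.val heq
    obtain rfl := h x y z hy hz
    rfl

theorem isTree_hasse_iff [Finite α] [OrderTop α] :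
    (SimpleGraph.hasse α).IsTree ↔ ∀ x y z : α, x ≤ y → x ≤ z → y ≤ z ∨ z ≤ y := by
  rw [isTree_hasse_iff_forall_covBy]
  constructor
  · intro h x
    induction x using WellFoundedGT.induction with
    | ind x ih =>
      intro y z hy hz
      rcases hy.eq_or_lt with rfl | hy
      · exact Or.inl hz
      rcases hz.eq_or_lt with rfl | hz
      · exact Or.inr hy.le
      obtain ⟨y', hxy', hy'⟩ := exists_covBy_le_of_lt hy
      obtain ⟨z', hxz', hz'⟩ := exists_covBy_le_of_lt hz
      obtain rfl := h x _ _ hxy' hxz'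
      exact ih y' hxy'.lt y z hy' hz'
  · intro h x y z hy hz
    rcases h x y z hy.le hz.le with hyz | hzy
    · exact hyz.eq_of_not_lt fun hlt => hz.2 hy.lt hlt
    · exact (hzy.eq_of_not_lt fun hlt => hy.2 hz.lt hlt).symm

end Hasse

/-- The values of `σ` at the positions in `[c, d)`. -/
def blockSet {n : ℕ} (σ : Equiv.Perm (Fin n)) (c d : ℕ) : Finset (Fin n) :=
  ({i | c ≤ (i : ℕ) ∧ (i : ℕ) < d} : Finset (Fin n)).map σ.toEmbedding

section BlockSet

variable {n c d c' d' : ℕ} {σ τ : Equiv.Perm (Fin n)} {I : Finset (Fin n)}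

theorem apply_mem_blockSet {i : Fin n} : σ i ∈ blockSet σ c d ↔ c ≤ (i : ℕ) ∧ (i : ℕ) < d := by
  simp [blockSet]

theorem blockSet_map : (blockSet σ c d).map (σ.symm.trans τ).toEmbedding = blockSet τ c d := by
  have hσ : σ.toEmbedding.trans (σ.symm.trans τ).toEmbedding = τ.toEmbedding :=
    Function.Embedding.ext fun i => congrArg τ (σ.symm_apply_apply i)
  rw [blockSet, Finset.map_map, hσ, blockSet]

theorem map_Icc_eq_blockSet (c d : Fin n) :
    (Finset.Icc c d).map σ.toEmbedding = blockSet σ c (d + 1) := by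
  refine congrArg (Finset.map σ.toEmbedding) (Finset.ext fun i => ?_)
  rw [Finset.mem_Icc, Finset.mem_filter_univ, Nat.lt_succ_iff, Fin.le_def, Fin.le_def]

theorem blockSet_subset_iff (hcd : c < d) (hd : d ≤ n) :
    blockSet σ c d ⊆ blockSet σ c' d' ↔ c' ≤ c ∧ d ≤ d' := by
  constructor
  · intro h
    have hfirst := apply_mem_blockSet.1 (h (apply_mem_blockSet (i := ⟨c, by omega⟩).2
      ⟨le_rfl, hcd⟩))
    have hlast := apply_mem_blockSet.1 (h (apply_mem_blockSet (i := ⟨d - 1, by omega⟩).2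
      ⟨Nat.le_sub_one_of_lt hcd, Nat.sub_one_lt_of_lt hcd⟩))
    simp only at hfirst hlast
    omega
  · intro h y hy
    obtain ⟨i, rfl⟩ := σ.surjective y
    rw [apply_mem_blockSet] at hy ⊢
    omega

theorem eq_and_eq_of_blockSet_eq (hcd : c < d) (hd : d ≤ n) (hcd' : c' < d') (hd' : d' ≤ n)
    (h : blockSet σ c d = blockSet σ c' d') : c = c' ∧ d = d' := by
  have hsub := (blockSet_subset_iff hcd hd).1 h.subset
  have hsup := (blockSet_subset_iff hcd' hd').1 h.superset
  omega

theorem exists_eq_blockSet (hne : I.Nonempty) (hI : IsInterval σ I) :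
    ∃ c d, (c, d) ∈ convexBlocks n (word σ) ∧ I = blockSet σ c d := by
  obtain ⟨⟨a, b, hab⟩, c, d, hcd⟩ := hI
  have hle : c ≤ d := by rwa [hcd, Finset.map_nonempty, Finset.nonempty_Icc] at hne
  have hIblock := hcd.trans (map_Icc_eq_blockSet c d)
  refine ⟨c, d + 1, mem_convexBlocks.2 ⟨Nat.lt_succ_of_le hle, d.2, ?_⟩, hIblock⟩
  intro x y z hx hx' hy hy' _ hz hxz hzy
  lift x to Fin n using hx'.trans_le d.2
  lift y to Fin n using hy'.trans_le d.2
  lift z to Fin n using hz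
  have hxI : σ x ∈ I := hIblock ▸ apply_mem_blockSet.2 ⟨hx, hx'⟩
  have hyI : σ y ∈ I := hIblock ▸ apply_mem_blockSet.2 ⟨hy, hy'⟩
  have hzI : σ z ∈ I := by
    rw [hab, Finset.mem_Icc] at hxI hyI ⊢
    exact ⟨hxI.1.trans ((word_le_iff σ x z).1 hxz), ((word_le_iff σ z y).1 hzy).trans hyI.2⟩
  rwa [hIblock, apply_mem_blockSet] at hzI

theorem nonempty_blockSet (hcd : c < d) (hd : d ≤ n) : (blockSet σ c d).Nonempty :=
  ⟨σ ⟨c, hcd.trans_le hd⟩, apply_mem_blockSet.2 ⟨le_rfl, hcd⟩⟩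

theorem isInterval_blockSet (h : (c, d) ∈ convexBlocks n (word σ)) :
    IsInterval σ (blockSet σ c d) := by
  obtain ⟨hcd, hd, hconv⟩ := mem_convexBlocks.1 h
  have hne : (blockSet σ c d).Nonempty := nonempty_blockSet hcd hd
  refine ⟨⟨(blockSet σ c d).min' hne, (blockSet σ c d).max' hne, ?_⟩, ⟨c, by omega⟩,
    ⟨d - 1, by omega⟩, ?_⟩
  · ext y
    rw [Finset.mem_Icc]
    refine ⟨fun hy => ⟨Finset.min'_le _ _ hy, Finset.le_max' _ _ hy⟩, fun ⟨hmin, hmax⟩ => ?_⟩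
    obtain ⟨z, rfl⟩ := σ.surjective y
    obtain ⟨a, ha⟩ := σ.surjective ((blockSet σ c d).min' hne)
    obtain ⟨b, hb⟩ := σ.surjective ((blockSet σ c d).max' hne)
    have ha' := apply_mem_blockSet.1 (ha ▸ Finset.min'_mem _ hne)
    have hb' := apply_mem_blockSet.1 (hb ▸ Finset.max'_mem _ hne)
    exact apply_mem_blockSet.2 <| hconv ha'.1 ha'.2 hb'.1 hb'.2 (Nat.zero_le _) z.2
      ((word_le_iff σ a z).2 (ha.trans_le hmin)) ((word_le_iff σ z b).2 (hmax.trans_eq hb.symm))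
  · rw [map_Icc_eq_blockSet]
    simp only
    rw [Nat.sub_add_cancel (by omega)]

theorem isInterval_iff_exists_blockSet (hne : I.Nonempty) : IsInterval σ I ↔
    ∃ c d, (c, d) ∈ convexBlocks n (word σ) ∧ I = blockSet σ c d :=
  ⟨exists_eq_blockSet hne, fun ⟨_, _, h, hI⟩ => hI ▸ isInterval_blockSet h⟩

theorem isInterval_map_iff_of_convexBlocks_eq
    (h : convexBlocks n (word σ) = convexBlocks n (word τ)) (hne : I.Nonempty) :
    IsInterval σ I ↔ IsInterval τ (I.map (σ.symm.trans τ).toEmbedding) := by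
  simp only [isInterval_iff_exists_blockSet hne, isInterval_iff_exists_blockSet hne.map,
    ← blockSet_map (σ := σ) (τ := τ), Finset.map_inj, h]

theorem isInterval_symm_map_iff :
    IsInterval σ I ↔ IsInterval σ.symm (I.map σ.symm.toEmbedding) := by
  have hmap (J : Finset (Fin n)) : I = J.map σ.toEmbedding ↔ I.map σ.symm.toEmbedding = J := by
    rw [← Finset.map_inj (f := σ.symm.toEmbedding), Finset.map_map]
    simp
  simp only [IsInterval, hmap, Finset.map_inj]
  exact and_comm

end BlockSet

section IntervalPoset

variable {n : ℕ} {σ τ : Equiv.Perm (Fin n)}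

/-- The block `[c, d)` of positions, as an element of the interval poset. -/
def blockInterval {c d : ℕ} (h : (c, d) ∈ convexBlocks n (word σ)) : NonemptyInterval σ :=
  ⟨blockSet σ c d, nonempty_blockSet (mem_convexBlocks.1 h).1 (mem_convexBlocks.1 h).2.1,
    isInterval_blockSet h⟩

theorem exists_eq_blockInterval (I : NonemptyInterval σ) :
    ∃ c d, ∃ h : (c, d) ∈ convexBlocks n (word σ), I = blockInterval h := by
  obtain ⟨c, d, h, hI⟩ := exists_eq_blockSet I.2.1 I.2.2
  exact ⟨c, d, h, Subtype.ext hI⟩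

theorem blockInterval_le_iff {c d c' d' : ℕ} (h : (c, d) ∈ convexBlocks n (word σ))
    (h' : (c', d') ∈ convexBlocks n (word σ)) :
    blockInterval h ≤ blockInterval h' ↔ c' ≤ c ∧ d ≤ d' :=
  blockSet_subset_iff (mem_convexBlocks.1 h).1 (mem_convexBlocks.1 h).2.1

theorem singletonInterval_apply_le_blockInterval_iff {c d : ℕ}
    (h : (c, d) ∈ convexBlocks n (word σ)) (i : Fin n) :
    singletonInterval σ (σ i) ≤ blockInterval h ↔ c ≤ (i : ℕ) ∧ (i : ℕ) < d :=
  Finset.singleton_subset_iff.trans apply_mem_blockSet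

theorem isTree_modifiedIntervalPoset_iff (hn : 0 < n) (σ : Equiv.Perm (Fin n)) :
    (modifiedIntervalPoset σ).IsTree ↔ IsLaminar (convexBlocks n (word σ)) := by
  let _ : OrderTop (NonemptyInterval σ) :=
    { top := blockInterval (zero_mem_convexBlocks hn)
      le_top := fun I => by
        obtain ⟨c, d, h, rfl⟩ := exists_eq_blockInterval I
        exact (blockInterval_le_iff h _).2 ⟨c.zero_le, (mem_convexBlocks.1 h).2.1⟩ }
  refine (isTree_hasse_iff (α := NonemptyInterval σ)).trans ⟨?_, ?_⟩
  · intro h c d c' d' hcd hcd' hcc' hc'd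
    obtain ⟨hlt, hd', -⟩ := mem_convexBlocks.1 hcd'
    have hcomp := h (singletonInterval σ (σ ⟨c', hlt.trans_le hd'⟩)) (blockInterval hcd)
      (blockInterval hcd')
      ((singletonInterval_apply_le_blockInterval_iff hcd _).2 ⟨hcc'.le, hc'd⟩)
      ((singletonInterval_apply_le_blockInterval_iff hcd' _).2 ⟨le_rfl, hlt⟩)
    rw [blockInterval_le_iff, blockInterval_le_iff] at hcomp
    omega
  · intro h K I J hKI hKJ
    obtain ⟨b, e, hbe, rfl⟩ := exists_eq_blockInterval K
    obtain ⟨c, d, hcd, rfl⟩ := exists_eq_blockInterval I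
    obtain ⟨c', d', hcd', rfl⟩ := exists_eq_blockInterval J
    have hlt : b < e := (mem_convexBlocks.1 hbe).1
    rw [blockInterval_le_iff] at hKI hKJ
    rw [blockInterval_le_iff, blockInterval_le_iff]
    have := @h c d c' d' hcd hcd'
    have := @h c' d' c d hcd' hcd
    omega

theorem convexBlocks_subset_of_same
    (h : (modifiedIntervalPoset σ).Same (modifiedIntervalPoset τ)) :
    convexBlocks n (word σ) ⊆ convexBlocks n (word τ) := by
  obtain ⟨e, he⟩ := h
  rintro ⟨c, d⟩ hcd
  obtain ⟨c', d', hcd', heq⟩ := exists_eq_blockInterval (e (blockInterval hcd))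
  have hmem (i : Fin n) : c ≤ (i : ℕ) ∧ (i : ℕ) < d ↔ c' ≤ (i : ℕ) ∧ (i : ℕ) < d' := by
    rw [← singletonInterval_apply_le_blockInterval_iff hcd,
      ← singletonInterval_apply_le_blockInterval_iff hcd', ← heq]
    exact (e.le_iff_le (x := singletonInterval σ (σ i)) (y := blockInterval hcd)).symm.trans
      (he i ▸ Iff.rfl)
  obtain ⟨hlt, hd, -⟩ := mem_convexBlocks.1 hcd
  obtain ⟨hlt', hd', -⟩ := mem_convexBlocks.1 hcd'
  have hcd_eq : c = c' ∧ d = d' := eq_and_eq_of_blockSet_eq (σ := τ) hlt hd hlt' hd' <|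
    congrArg (Finset.map τ.toEmbedding) (by ext i; simpa using hmem i)
  rwa [hcd_eq.1, hcd_eq.2]

/-- The isomorphism of interval posets which is induced by a permutation of the values. -/
def intervalOrderIso (f : Equiv.Perm (Fin n))
    (h : ∀ I, I.Nonempty → (IsInterval σ I ↔ IsInterval τ (I.map f.toEmbedding))) :
    NonemptyInterval σ ≃o NonemptyInterval τ where
  toEquiv := (Equiv.finsetCongr f).subtypeEquiv fun I =>
    (and_congr_right fun hne => h I hne).trans (and_congr_left' Finset.map_nonempty.symm)
  map_rel_iff' := Finset.map_subset_map

theorem same_modifiedIntervalPoset_iff :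
    (modifiedIntervalPoset σ).Same (modifiedIntervalPoset τ) ↔
      convexBlocks n (word σ) = convexBlocks n (word τ) := by
  refine ⟨fun h => (convexBlocks_subset_of_same h).antisymm
    (convexBlocks_subset_of_same ((PlanePoset.setoid n).symm h)), fun h => ?_⟩
  refine ⟨intervalOrderIso (σ.symm.trans τ) fun I => isInterval_map_iff_of_convexBlocks_eq h,
    fun i => Subtype.ext ?_⟩
  change ({σ i} : Finset (Fin n)).map (σ.symm.trans τ).toEmbedding = {τ i}
  simp only [Finset.map_singleton, Equiv.coe_toEmbedding, Equiv.trans_apply,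
    Equiv.symm_apply_apply]

theorem same_originalIntervalPoset_modifiedIntervalPoset_symm (σ : Equiv.Perm (Fin n)) :
    (originalIntervalPoset σ).Same (modifiedIntervalPoset σ.symm) :=
  ⟨intervalOrderIso σ.symm fun _ _ => isInterval_symm_map_iff,
    fun i => Subtype.ext (Finset.map_singleton σ.symm.toEmbedding i)⟩

theorem PlanePoset.Same.isTree_iff {P Q : PlanePoset n} (h : P.Same Q) : P.IsTree ↔ Q.IsTree := by
  obtain ⟨e, -⟩ := h
  let f : SimpleGraph.hasse P.carrier ≃g SimpleGraph.hasse Q.carrier :=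
    { toEquiv := e.toEquiv
      map_rel_iff' := or_congr (apply_covBy_apply_iff e) (apply_covBy_apply_iff e) }
  exact f.isTree_iff

theorem originalTreeIntervalPosets_eq (n : ℕ) :
    originalTreeIntervalPosets n = treeIntervalPosets n := by
  ext q
  constructor
  · rintro ⟨σ, hσ, rfl⟩
    have h := same_originalIntervalPoset_modifiedIntervalPoset_symm σ
    exact ⟨σ.symm, h.isTree_iff.1 hσ, Quotient.sound h⟩
  · rintro ⟨σ, hσ, rfl⟩
    have h := same_originalIntervalPoset_modifiedIntervalPoset_symm σ.symm
    rw [Equiv.symm_symm] at h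
    exact ⟨σ.symm, h.isTree_iff.2 hσ, (Quotient.sound h).symm⟩

theorem ncard_treeIntervalPosets (hn : 0 < n) :
    (treeIntervalPosets n).ncard = Nat.card (PlaneForest {3}ᶜ 1 n) := by
  choose v hv hblocks using
    PlaneForest.exists_convexBlocks_eq_blocks (n := n) (A := {3}ᶜ) (not_not.2 rfl)
  choose σ hσ using fun f => exists_convexBlocks_word_eq (hv f)
  have hσ_blocks (f) : convexBlocks n (word (σ f)) = f.blocks := (hσ f).trans (hblocks f)
  let toPoset (f : PlaneForest {3}ᶜ 1 n) : Quotient (PlanePoset.setoid n) :=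
    ⟦modifiedIntervalPoset (σ f)⟧
  have hinj : Function.Injective toPoset := fun f g h => PlaneForest.blocks_injective <| by
    rw [← hσ_blocks, ← hσ_blocks]
    exact same_modifiedIntervalPoset_iff.1 (Quotient.exact h)
  have hrange : treeIntervalPosets n = Set.range toPoset := by
    ext q
    constructor
    · rintro ⟨τ, hτ, rfl⟩
      obtain ⟨f, hf⟩ := exists_planeForest_blocks_eq_convexBlocks hn (injOn_word τ)
        ((isTree_modifiedIntervalPoset_iff hn τ).1 hτ)
      exact ⟨f, Quotient.sound (same_modifiedIntervalPoset_iff.2 ((hσ_blocks f).trans hf))⟩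
    · rintro ⟨f, rfl⟩
      refine ⟨σ f, (isTree_modifiedIntervalPoset_iff hn _).2 ?_, rfl⟩
      rw [hσ_blocks]
      exact f.isLaminar_blocks
  rw [hrange, ← Set.image_univ, Set.ncard_image_of_injective _ hinj, Set.ncard_univ]

end IntervalPoset

end IntervalPosets

theorem mainTheorem7 (n : ℕ) (hn : 1 ≤ n) :
    ((IntervalPosets.treeIntervalPosets n).ncard : ℚ) = IntervalPosets.treeFormula n ∧
      ((IntervalPosets.originalTreeIntervalPosets n).ncard : ℚ) =
        IntervalPosets.treeFormula n := by
  rw [IntervalPosets.originalTreeIntervalPosets_eq, and_self,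
    IntervalPosets.ncard_treeIntervalPosets hn]
  exact IntervalPosets.card_planeForest_compl_three hn
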